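/- Let $E>0$ and $N\ge 0$. For $\alpha\in\mathbb C$ let $S_N(\alpha)$ be the displaced thermal state on the one-mode Fock space with $N$ mean thermal photons and displacement $\alpha$, that is $S_N(\alpha)=\frac1{\pi N}\int_{\mathbb C}e^{-|z-\alpha|^2/N}\,|z\rangle\langle z|\,d^2z$ with coherent states $|z\rangle$ (and $S_0(\alpha)=|\alpha\rangle\langle\alpha|$), and for $\alpha^k\in\mathbb C^k$ let $S_N^k(\alpha^k)=S_N(\alpha_1)\otimes\cdots\otimes S_N(\alpha_k)$. A $(k,M,\lambda_1,\lambda_2)$ deterministic identification scheme consists of signatures $\alpha_1^k,\dots,\alpha_M^k\in\mathbb C^k$ with $\|\alpha_m^k\|^2\le kE$ and operators $0\le\Pi_m\le\mathbb 1$ on the $k$-mode Fock space such that $1-\mathrm{tr}[S_N^k(\alpha_m^k)\Pi_m]\le\lambda_1$ for all $m$ and $\mathrm{tr}[S_N^k(\alpha_{m'}^k)\Pi_m]\le\lambda_2$ for all $m'\ne m$. The deterministic identification capacity $C_{ID}$ of the noisy bosonic classical-quantum channel $\alpha\mapsto S_N(\alpha)$ (normalized by $k\log k$) is the supremum of all $R$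 for which there are $(k,M_k,\lambda_{1,k},\lambda_{2,k})$ schemes, $k\in\mathbb N$, with $\lambda_{1,k}\to0$, $\lambda_{2,k}\to 0$ and $\liminf_{k\to\infty}\frac{\log M_k}{k\log k}\ge R$. Then $C_{ID}=1$. Moreover, for all fixed error levels $\lambda_1,\lambda_2>0$ with $\lambda_1+\lambda_2<1$, the maximal number $M^*(k,\lambda_1,\lambda_2)$ of users in a $(k,M,\lambda_1,\lambda_2)$ scheme is finite for every $k$ and $$\lim_{k\to\infty}\frac{\log M^*(k,\lambda_1,\lambda_2)}{k\log k}=1 .$$ -/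

import Mathlib

open Filter Topology MeasureTheory ProbabilityTheory
open scoped NNReal ENNReal ComplexConjugate

namespace BosonicID

/-! ### Fock spaces -/

/-- The Fock space of one bosonic mode, written in the photon-number basis: `ℓ²(ℕ)`. -/
abbrev Mode : Type := lp (fun _ : ℕ => ℂ) 2

/-- The Fock space of `k` bosonic modes, i.e. the Hilbert space tensor product of `k` copies of
`ℓ²(ℕ)`, written in the product photon-number basis: `ℓ²(ℕ^k)`. -/
abbrev Fock (k : ℕ) : Type := lp (fun _ : Fin k → ℕ => ℂ) 2

/-- The number state `|n⟩` of one mode. -/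
noncomputable def modeNumber (n : ℕ) : Mode := lp.single 2 n (1 : ℂ)

/-- The number state `|n₁⟩ ⊗ ⋯ ⊗ |n_k⟩` of `k` modes. -/
noncomputable def fockNumber {k : ℕ} (n : Fin k → ℕ) : Fock k := lp.single 2 n (1 : ℂ)

theorem summable_prod_norm {k : ℕ} (f : Fin k → ℕ → ℝ) (h0 : ∀ i n, 0 ≤ f i n)
    (hf : ∀ i, Summable (f i)) : Summable fun n : Fin k → ℕ => ∏ i, f i (n i) := by
  classical
  refine summable_of_sum_le (c := ∏ i, ∑' n, f i n)
    (fun n => Finset.prod_nonneg fun i _ => h0 i _) fun u => ?_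
  calc ∑ n ∈ u, ∏ i, f i (n i)
      ≤ ∑ n ∈ Fintype.piFinset (fun i => u.image fun n => n i), ∏ i, f i (n i) := by
        refine Finset.sum_le_sum_of_subset_of_nonneg (fun n hn => ?_)
          fun n _ _ => Finset.prod_nonneg fun i _ => h0 i _
        rw [Fintype.mem_piFinset]
        exact fun i => Finset.mem_image_of_mem _ hn
    _ = ∏ i, ∑ n ∈ u.image (fun n => n i), f i n := (Finset.prod_univ_sum _ _).symm
    _ ≤ ∏ i, ∑' n, f i n :=
        Finset.prod_le_prod (fun i _ => Finset.sum_nonneg fun n _ => h0 i n)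
          fun i _ => (hf i).sum_le_tsum _ fun n _ => h0 i n

theorem tsum_prod_eq {k : ℕ} (f : Fin k → ℕ → ℂ) (hf : ∀ i, Summable fun n => ‖f i n‖) :
    ∑' n : Fin k → ℕ, ∏ i, f i (n i) = ∏ i, ∑' n, f i n := by
  classical
  have hs : Summable fun n : Fin k → ℕ => ∏ i, f i (n i) := by
    refine Summable.of_norm ?_
    simpa only [norm_prod] using
      summable_prod_norm (fun i n => ‖f i n‖) (fun i n => norm_nonneg _) hf
  have hbox : Tendsto (fun N : ℕ => Fintype.piFinset fun _ : Fin k => Finset.range N)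
      atTop atTop := by
    refine tendsto_atTop_finset_of_monotone
      (fun a b hab => Fintype.piFinset_subset _ _ fun _ => Finset.range_mono hab) fun n => ?_
    refine ⟨(∑ i, n i) + 1, ?_⟩
    rw [Fintype.mem_piFinset]
    intro i
    rw [Finset.mem_range, Nat.lt_succ_iff]
    exact Finset.single_le_sum (fun j _ => Nat.zero_le (n j)) (Finset.mem_univ i)
  refine tendsto_nhds_unique (hs.hasSum.comp hbox) ?_
  have : (fun s : Finset (Fin k → ℕ) => ∑ n ∈ s, ∏ i, f i (n i)) ∘
      (fun N : ℕ => Fintype.piFinset fun _ : Fin k => Finset.range N) =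
      fun N => ∏ i, ∑ n ∈ Finset.range N, f i n := by
    funext N
    exact (Finset.prod_univ_sum _ _).symm
  rw [this]
  exact tendsto_finsetProd _ fun i _ => (Summable.of_norm (hf i)).hasSum.tendsto_sum_nat

theorem memlp_tensor {k : ℕ} (v : Fin k → Mode) :
    Memℓp (fun n : Fin k → ℕ => ∏ i, v i (n i)) 2 := by
  refine memℓp_gen ?_
  have h : ∀ i, Summable fun n => ‖v i n‖ ^ 2 := fun i => by
    simpa using (lp.memℓp (v i)).summable (by simp)
  simpa [norm_prod, Finset.prod_pow] using
    summable_prod_norm (fun i n => ‖v i n‖ ^ 2) (fun i n => by positivity) h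

/-- The product vector `v₁ ⊗ ⋯ ⊗ v_k`. -/
noncomputable def tensor {k : ℕ} (v : Fin k → Mode) : Fock k :=
  ⟨fun n => ∏ i, v i (n i), memlp_tensor v⟩

theorem tensor_apply {k : ℕ} (v : Fin k → Mode) (n : Fin k → ℕ) :
    tensor v n = ∏ i, v i (n i) := rfl

theorem inner_tensor {k : ℕ} (v w : Fin k → Mode) :
    inner ℂ (tensor v) (tensor w) = ∏ i, inner ℂ (v i) (w i) := by
  have h := tsum_prod_eq (fun i n => inner ℂ (v i n) (w i n))
    fun i => (lp.summable_inner (𝕜 := ℂ) (v i) (w i)).norm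
  have h2 : ∀ n : Fin k → ℕ, inner ℂ (tensor v n) (tensor w n) =
      ∏ i, inner ℂ (v i (n i)) (w i (n i)) := fun n => by
    simp only [tensor_apply, RCLike.inner_apply, map_prod, Finset.prod_mul_distrib]
  rw [lp.inner_eq_tsum, tsum_congr h2, h]
  exact Finset.prod_congr rfl fun i _ => (lp.inner_eq_tsum (𝕜 := ℂ) (v i) (w i)).symm

/-! ### Coherent states -/

theorem memlp_coherent (z : ℂ) :
    Memℓp (fun n : ℕ => Complex.exp (-(‖z‖ ^ 2 / 2 : ℝ)) * z ^ n / (√(n.factorial : ℝ) : ℂ)) 2 := by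
  refine memℓp_gen ?_
  have h := (Real.summable_pow_div_factorial (‖z‖ ^ 2)).mul_left (Real.exp (-(‖z‖ ^ 2 / 2)) ^ 2)
  refine h.congr fun n => ?_
  have h1 : ‖Complex.exp (-(‖z‖ ^ 2 / 2 : ℝ))‖ = Real.exp (-(‖z‖ ^ 2 / 2)) := by
    rw [Complex.norm_exp]; norm_cast
  rw [ENNReal.toReal_ofNat, Real.rpow_ofNat, norm_div, norm_mul, h1, norm_pow, Complex.norm_real,
    Real.norm_of_nonneg (Real.sqrt_nonneg _), div_pow, mul_pow, Real.sq_sqrt (by positivity)]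
  ring

/-- The coherent state `|z⟩ = e^{-|z|²/2} ∑ₙ zⁿ / √(n!) |n⟩` of one mode. -/
noncomputable def coherent (z : ℂ) : Mode :=
  ⟨fun n => Complex.exp (-(‖z‖ ^ 2 / 2 : ℝ)) * z ^ n / (√(n.factorial : ℝ) : ℂ),
    memlp_coherent z⟩

theorem coherent_apply (z : ℂ) (n : ℕ) :
    coherent z n = Complex.exp (-(‖z‖ ^ 2 / 2 : ℝ)) * z ^ n / (√(n.factorial : ℝ) : ℂ) := rfl

theorem inner_coherent (z w : ℂ) : inner ℂ (coherent z) (coherent w) =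
    Complex.exp (-(‖z‖ ^ 2 / 2 : ℝ) - (‖w‖ ^ 2 / 2 : ℝ) + conj z * w) := by
  have hexp : Complex.exp (conj z * w) = ∑' n : ℕ, (conj z * w) ^ n / (n.factorial : ℂ) := by
    rw [Complex.exp_eq_exp_ℂ, NormedSpace.exp_eq_tsum_div (𝔸 := ℂ)]
  rw [lp.inner_eq_tsum, sub_eq_add_neg, Complex.exp_add, Complex.exp_add, hexp, ← tsum_mul_left]
  refine tsum_congr fun n => ?_
  have h2 : ((√(n.factorial : ℝ) : ℝ) : ℂ) * ((√(n.factorial : ℝ) : ℝ) : ℂ) = n.factorial := by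
    rw [← Complex.ofReal_mul, Real.mul_self_sqrt (by positivity)]; simp
  have h3 : ((√(n.factorial : ℝ) : ℝ) : ℂ) ≠ 0 := by
    rw [Complex.ofReal_ne_zero]; positivity
  rw [RCLike.inner_apply, coherent_apply, coherent_apply, ← h2, map_div₀,
    map_mul, map_pow, ← Complex.exp_conj, map_neg, Complex.conj_ofReal, Complex.conj_ofReal]
  field_simp
  rw [mul_pow, mul_comm]

/-- The coherent product state `|z₁⟩ ⊗ ⋯ ⊗ |z_k⟩`. -/
noncomputable def coherentProd {k : ℕ} (z : Fin k → ℂ) : Fock k := tensor fun i => coherent (z i)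

theorem norm_coherent (z : ℂ) : ‖coherent z‖ = 1 := by
  have h := inner_self_eq_norm_sq_to_K (𝕜 := ℂ) (coherent z)
  have h2 : (-(‖z‖ ^ 2 / 2 : ℝ) - (‖z‖ ^ 2 / 2 : ℝ) + conj z * z : ℂ) = 0 := by
    rw [mul_comm, Complex.mul_conj, Complex.normSq_eq_norm_sq]; push_cast; ring
  rw [inner_coherent, h2, Complex.exp_zero] at h
  have h3 : ‖coherent z‖ ^ 2 = 1 := by
    refine Complex.ofReal_injective ?_
    rw [Complex.ofReal_pow, Complex.ofReal_one]
    exact h.symm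
  nlinarith [norm_nonneg (coherent z)]

theorem norm_coherentProd {k : ℕ} (z : Fin k → ℂ) : ‖coherentProd z‖ = 1 := by
  have h := inner_self_eq_norm_sq_to_K (𝕜 := ℂ) (coherentProd z)
  have h2 : inner ℂ (coherentProd z) (coherentProd z) = 1 := by
    rw [coherentProd, inner_tensor]
    refine Finset.prod_eq_one fun i _ => ?_
    rw [inner_self_eq_norm_sq_to_K, norm_coherent]
    simp
  rw [h2] at h
  have h3 : ‖coherentProd z‖ ^ 2 = 1 := by
    refine Complex.ofReal_injective ?_
    rw [Complex.ofReal_pow, Complex.ofReal_one]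
    exact h.symm
  nlinarith [norm_nonneg (coherentProd z)]

theorem continuous_of_inner {X E : Type*} [TopologicalSpace X] [NormedAddCommGroup E]
    [InnerProductSpace ℂ E] (f : X → E)
    (h : Continuous fun p : X × X => inner ℂ (f p.1) (f p.2)) : Continuous f := by
  rw [continuous_iff_continuousAt]
  intro x
  rw [ContinuousAt, tendsto_iff_norm_sub_tendsto_zero]
  have e : ∀ y, ‖f y - f x‖ = √(RCLike.re (inner ℂ (f y) (f y)) - 2 * RCLike.re (inner ℂ (f y) (f x))
      + RCLike.re (inner ℂ (f x) (f x))) := fun y => by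
    rw [inner_self_eq_norm_sq, inner_self_eq_norm_sq, ← norm_sub_sq, Real.sqrt_sq (norm_nonneg _)]
  have h1 : Continuous fun y => inner ℂ (f y) (f y) := h.comp (continuous_id.prodMk continuous_id)
  have h2 : Continuous fun y => inner ℂ (f y) (f x) := h.comp (continuous_id.prodMk continuous_const)
  have hc : Continuous fun y => ‖f y - f x‖ := by
    simp only [e]
    exact (((RCLike.continuous_re.comp h1).sub
      (continuous_const.mul (RCLike.continuous_re.comp h2))).add continuous_const).sqrt
  simpa using hc.tendsto x

theorem continuous_coherent : Continuous coherent := by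
  refine continuous_of_inner _ ?_
  simp only [inner_coherent]
  have := Complex.continuous_conj
  fun_prop

theorem continuous_coherentProd {k : ℕ} : Continuous (coherentProd (k := k)) := by
  refine continuous_of_inner _ ?_
  simp only [coherentProd, inner_tensor, inner_coherent]
  have := Complex.continuous_conj
  fun_prop

/-! ### Displaced thermal states -/

/-- The operator `|v⟩⟨v|`. -/
noncomputable def proj {E : Type*} [NormedAddCommGroup E] [InnerProductSpace ℂ E] (v : E) :
    E →L[ℂ] E := InnerProductSpace.rankOne ℂ v v

/-- The circularly symmetric complex Gaussian law with mean `α` and `𝔼|z - α|² = N`. It has density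
`(π N)⁻¹ exp (-|z - α|² / N)` for `N > 0` and is the point mass at `α` for `N = 0`. -/
noncomputable def complexGaussian (α : ℂ) (N : ℝ≥0) : Measure ℂ :=
  ((gaussianReal α.re (N / 2)).prod (gaussianReal α.im (N / 2))).map
    Complex.measurableEquivRealProd.symm

instance (α : ℂ) (N : ℝ≥0) : IsProbabilityMeasure (complexGaussian α N) :=
  Measure.isProbabilityMeasure_map (MeasurableEquiv.measurable _).aemeasurable

/-- The displaced thermal state `S_N(α)` of one mode: the Gaussian mixture
`S_N(α) = (π N)⁻¹ ∫ exp (-|z - α|² / N) |z⟩⟨z| d²z` of coherent states (`|α⟩⟨α|` if `N = 0`). -/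
noncomputable def displacedThermal (N : ℝ≥0) (α : ℂ) : Mode →L[ℂ] Mode :=
  ∫ z, proj (coherent z) ∂(complexGaussian α N)

/-- The received state `S_N(α₁) ⊗ ⋯ ⊗ S_N(α_k)` of `k` modes, as the corresponding mixture of
coherent product states; see `inner_receivedState` for the tensor product structure. -/
noncomputable def receivedState (N : ℝ≥0) {k : ℕ} (α : EuclideanSpace ℂ (Fin k)) :
    Fock k →L[ℂ] Fock k :=
  ∫ z : Fin k → ℂ, proj (coherentProd z) ∂(Measure.pi fun i => complexGaussian (α i) N)

theorem integrable_proj {X E : Type*} [TopologicalSpace X] [SecondCountableTopology X]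
    [MeasurableSpace X] [OpensMeasurableSpace X] [NormedAddCommGroup E] [InnerProductSpace ℂ E]
    (f : X → E) (hf : Continuous f) (h1 : ∀ x, ‖f x‖ = 1) (μ : Measure X) [IsFiniteMeasure μ] :
    Integrable (fun x => proj (f x)) μ := by
  have hc : Continuous fun x => proj (f x) :=
    (ContinuousLinearMap.smulRightL ℂ E E).continuous₂.comp
      (((innerSL ℂ).continuous.comp hf).prodMk hf)
  refine Integrable.of_bound hc.aestronglyMeasurable 1 (ae_of_all _ fun x => ?_)
  simp [proj, h1]

theorem inner_integral_proj {X E : Type*} [TopologicalSpace X] [SecondCountableTopology X]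
    [MeasurableSpace X] [OpensMeasurableSpace X] [NormedAddCommGroup E] [InnerProductSpace ℂ E]
    [CompleteSpace E] (f : X → E) (hf : Continuous f) (h1 : ∀ x, ‖f x‖ = 1) (μ : Measure X)
    [IsFiniteMeasure μ] (u v : E) :
    inner ℂ u ((∫ x, proj (f x) ∂μ) v) = ∫ x, inner ℂ u (f x) * inner ℂ (f x) v ∂μ := by
  have hi := integrable_proj f hf h1 μ
  rw [ContinuousLinearMap.integral_apply hi, ← integral_inner (hi.apply_continuousLinearMap v)]
  refine integral_congr_ae (ae_of_all _ fun x => ?_)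
  simp [proj, inner_smul_right, mul_comm]

/-- `receivedState N α` is the tensor product of the states `S_N(αᵢ)`: its matrix elements between
number states, which determine it, are the products of those of the factors. -/
theorem inner_receivedState (N : ℝ≥0) {k : ℕ} (α : EuclideanSpace ℂ (Fin k)) (m n : Fin k → ℕ) :
    inner ℂ (fockNumber m) (receivedState N α (fockNumber n)) =
      ∏ i, inner ℂ (modeNumber (m i)) (displacedThermal N (α i) (modeNumber (n i))) := by
  have h1 := inner_integral_proj (coherentProd (k := k)) continuous_coherentProd norm_coherentProd
    (Measure.pi fun i => complexGaussian (α i) N) (fockNumber m) (fockNumber n)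
  have h2 := fun i => inner_integral_proj coherent continuous_coherent norm_coherent
    (complexGaussian (α i) N) (modeNumber (m i)) (modeNumber (n i))
  refine h1.trans (Eq.trans ?_ (Finset.prod_congr rfl fun i _ => (h2 i).symm))
  rw [← integral_fintype_prod_eq_prod]
  refine integral_congr_ae (ae_of_all _ fun z => ?_)
  simp [fockNumber, modeNumber, lp.inner_single_left, lp.inner_single_right, coherentProd,
    tensor_apply, Finset.prod_mul_distrib]

/-- The trace `∑ₙ ⟨n| A |n⟩` of an operator on the `k`-mode Fock space. It is used below only for
products `A = ρ Π` of a density operator and a bounded operator, which are trace class, so that the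
series converges absolutely. -/
noncomputable def trace {k : ℕ} (A : Fock k →L[ℂ] Fock k) : ℂ :=
  ∑' n : Fin k → ℕ, inner ℂ (fockNumber n) (A (fockNumber n))

/-! ### Identification schemes -/

/-- A `(k, M, l₁, l₂)` deterministic multi-user identification scheme with coherent-state signatures
for the channel `α ↦ S_N(α)` under the average energy constraint `E`. -/
structure Scheme (E : ℝ) (N : ℝ≥0) (k M : ℕ) (l₁ l₂ : ℝ) where
  /-- the amplitudes of the coherent product state assigned to each user -/
  signature : Fin M → EuclideanSpace ℂ (Fin k)
  /-- the operator of the outcome "yes" of the binary test of each user -/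
  test : Fin M → (Fock k →L[ℂ] Fock k)
  energy : ∀ m, ‖signature m‖ ^ 2 ≤ k * E
  test_nonneg : ∀ m, 0 ≤ test m
  test_le_one : ∀ m, test m ≤ 1
  first_kind : ∀ m, 1 - (trace (receivedState N (signature m) * test m)).re ≤ l₁
  second_kind : ∀ m m', m' ≠ m → (trace (receivedState N (signature m') * test m)).re ≤ l₂

/-- The rate `R` (in units of `k log k`) is achievable: there are schemes for every number `k` of
channel uses, with both errors tending to zero and
`liminf_k log (M k) / (k log k) ≥ R`. -/
def Achievable (E : ℝ) (N : ℝ≥0) (R : ℝ) : Prop :=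
  ∃ (M : ℕ → ℕ) (l₁ l₂ : ℕ → ℝ),
    (∀ k, Nonempty (Scheme E N k (M k) (l₁ k) (l₂ k))) ∧
    Tendsto l₁ atTop (𝓝 0) ∧ Tendsto l₂ atTop (𝓝 0) ∧
    ∀ R' < R, ∀ᶠ k : ℕ in atTop, R' * (k * Real.log k) ≤ Real.log (M k)

/-- The deterministic identification capacity, normalized by `k log k`: the supremum, in the
extended reals, of the achievable rates. -/
noncomputable def idCapacity (E : ℝ) (N : ℝ≥0) : EReal :=
  sSup (Real.toEReal '' {R : ℝ | Achievable E N R})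

end BosonicID

namespace BosonicID

/-! ### Packings of balls -/

section Packing

variable {V : Type*} [NormedAddCommGroup V] [NormedSpace ℝ V] [FiniteDimensional ℝ V]

/-! The count of users is a packing count in real dimension `2k` inside a ball of radius `√(kE)`.
Since log `M` is about `2k` times the logarithm of radius over separation, any separation growing
slower than every power of `k` gives `2k · ½ log k = k log k`.

Converse. Translating the same Gaussian amplitude noise reduces two received states to two families
of coherent states, whose overlaps depend only on the displacement. Hence every test changes its
acceptance probability by at most `2‖α - β‖` (`re_trace_sub_le`). A scheme with `l₁ + l₂ < 1`
therefore has signatures separated by a constant, and comparing volumes (`Scheme.card_le`) bounds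
`M`. The bound uses only that `1 - l₁ - l₂` stays away from zero, so it is a strong converse.

Achievability. Heterodyne detection turns the channel into classical Gaussian noise of variance `N +
1` per mode. Along a fixed direction this noise is of order one, so a half-space test needs only a
margin of order `log k`; but a user's test must intersect few half-spaces for the union bound to
survive, while it must reject superexponentially many other users. `exists_code` resolves this with
`J` additional coordinates. A coarse packing of scale `D ^ (3/4)` in a ball of scale `D` is lifted
to a paraboloid, whose tangent half-space at one point cuts off all points of other cells at once.
Each cell is filled with a smaller copy of the construction. After `J` levels the unresolved scale
is `D ^ θ` with `θ = (3/4) ^ J`, and the rate is `1 - θ`; the `J` extra modes cost nothing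
asymptotically. -/

theorem card_le_of_separated {ι : Type*} [Fintype ι] (f : ι → V) {R r : ℝ} (hR : 0 ≤ R)
    (hr : 0 < r) (hf : ∀ i, ‖f i‖ ≤ R) (hsep : ∀ i j, i ≠ j → 2 * r ≤ ‖f i - f j‖) :
    (Fintype.card ι : ℝ) ≤ ((R + r) / r) ^ Module.finrank ℝ V := by
  let _ : MeasurableSpace V := borel V
  have : BorelSpace V := ⟨rfl⟩
  set μ : Measure V := Measure.addHaar
  have hdisj : Pairwise (Function.onFun Disjoint fun i => Metric.ball (f i) r) := fun i j hij => by
    refine Metric.ball_disjoint_ball ?_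
    rw [dist_eq_norm]
    linarith [hsep i j hij]
  have hsub : (⋃ i, Metric.ball (f i) r) ⊆ Metric.ball 0 (R + r) := by
    refine Set.iUnion_subset fun i => Metric.ball_subset_ball' ?_
    rw [dist_zero_right]
    linarith [hf i]
  have h := measure_mono (μ := μ) hsub
  rw [measure_iUnion hdisj fun i => Metric.isOpen_ball.measurableSet, tsum_fintype] at h
  simp only [Measure.addHaar_ball_of_pos μ _ hr, Measure.addHaar_ball_of_pos μ _ (add_pos_of_nonneg_of_pos hR hr),
    Finset.sum_const, Finset.card_univ, nsmul_eq_mul] at h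
  have h0 : μ (Metric.ball 0 1) ≠ 0 := (Metric.measure_ball_pos μ _ one_pos).ne'
  have h1 : μ (Metric.ball 0 1) ≠ ∞ := measure_ball_lt_top.ne
  rw [← mul_assoc, ENNReal.mul_le_mul_iff_left h0 h1, ← ENNReal.ofReal_natCast,
    ← ENNReal.ofReal_mul (by positivity), ENNReal.ofReal_le_ofReal_iff (by positivity)] at h
  rw [div_pow, le_div_iff₀ (by positivity)]
  exact h

theorem exists_separated (ρ d : ℝ) (hρ : 0 ≤ ρ) (hd : 0 < d) :
    ∃ P : Finset V, (∀ x ∈ P, ‖x‖ ≤ ρ) ∧ (∀ x ∈ P, ∀ y ∈ P, x ≠ y → d ≤ ‖x - y‖) ∧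
      (ρ / d) ^ Module.finrank ℝ V ≤ P.card := by
  classical
  -- A separated set of maximal size exists by the volume bound. By maximality the balls of radius
  -- `d` around its points cover the ball of radius `ρ`, and comparing volumes bounds its size from
  -- below.
  let Q : ℕ → Prop := fun n => ∃ P : Finset V, P.card = n ∧ (∀ x ∈ P, ‖x‖ ≤ ρ) ∧
    ∀ x ∈ P, ∀ y ∈ P, x ≠ y → d ≤ ‖x - y‖
  have hb : ∀ n, Q n → n ≤ ⌊((ρ + d / 2) / (d / 2)) ^ Module.finrank ℝ V⌋₊ := by
    rintro n ⟨P, rfl, h1, h2⟩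
    refine Nat.le_floor ?_
    have := card_le_of_separated (fun x : P => (x : V)) hρ (half_pos hd) (fun x => h1 x x.2)
      fun x y hxy => by
        have := h2 x x.2 y y.2 fun h => hxy (Subtype.ext h)
        linarith
    simpa using this
  obtain ⟨n, ⟨P, hPn, h1, h2⟩, hmax⟩ : ∃ n, Q n ∧ ∀ m, Q m → m ≤ n :=
    ⟨_, Nat.findGreatest_spec (P := Q) (Nat.zero_le _) ⟨∅, by simp⟩,
      fun m hm => Nat.le_findGreatest (hb m hm) hm⟩
  refine ⟨P, h1, h2, ?_⟩
  have hcov : Metric.closedBall (0 : V) ρ ⊆ ⋃ x ∈ P, Metric.ball x d := by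
    intro y hy
    rw [mem_closedBall_zero_iff] at hy
    by_contra hc
    simp only [Set.mem_iUnion, Metric.mem_ball, not_exists, not_lt, dist_eq_norm] at hc
    have hyP : y ∉ P := fun h => by simpa [hd.not_ge] using hc y h
    have hQ : Q (P.card + 1) := by
      refine ⟨insert y P, Finset.card_insert_of_notMem hyP, ?_, ?_⟩
      · simpa [hy] using h1
      · intro a ha b hb hab
        rw [Finset.mem_insert] at ha hb
        rcases ha with rfl | ha <;> rcases hb with rfl | hb
        · exact absurd rfl hab
        · exact hc b hb
        · rw [norm_sub_rev]; exact hc a ha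
        · exact h2 a ha b hb hab
    have := hmax _ hQ
    omega
  let _ : MeasurableSpace V := borel V
  have : BorelSpace V := ⟨rfl⟩
  set μ : Measure V := Measure.addHaar
  have h := (measure_mono (μ := μ) hcov).trans (measure_biUnion_finset_le P _)
  simp only [Measure.addHaar_ball_of_pos μ _ hd, Measure.addHaar_closedBall μ _ hρ,
    Finset.sum_const, nsmul_eq_mul] at h
  have h0 : μ (Metric.ball 0 1) ≠ 0 := (Metric.measure_ball_pos μ _ one_pos).ne'
  have h1 : μ (Metric.ball 0 1) ≠ ∞ := measure_ball_lt_top.ne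
  rw [← mul_assoc, ENNReal.mul_le_mul_iff_left h0 h1, ← ENNReal.ofReal_natCast,
    ← ENNReal.ofReal_mul (by positivity), ENNReal.ofReal_le_ofReal_iff (by positivity)] at h
  rw [div_pow, div_le_iff₀ (by positivity)]
  exact h

end Packing

/-! ### Hierarchical codes -/

section Code

variable {V : Type} [NormedAddCommGroup V] [InnerProductSpace ℝ V] [FiniteDimensional ℝ V]

/-- The points `(f x, y x 0, …, y x (J - 1))` of `V × ℝ^J` admit, for each `x`, a family of `J`
half-spaces containing `x` deeply inside such that every other point is cut off by at least one of
them. -/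
theorem exists_code (τ : ℝ) (J : ℕ) (D : ℝ) (hD : 1 ≤ D)
    (h16 : 16 ≤ D ^ ((3 / 4 : ℝ) ^ J)) (hτ : 4 * τ ^ 2 ≤ D ^ ((3 / 4 : ℝ) ^ J)) :
    ∃ (ι : Type) (_ : Fintype ι) (f : ι → V) (y : ι → ℕ → ℝ) (g : ι → ℕ → V),
      (∀ x, ‖f x‖ ≤ D / 4) ∧ (∀ x j, |y x j| ≤ D / 8) ∧ (∀ x j, ‖g x j‖ ≤ 1) ∧
      (∀ x x', x ≠ x' → ∃ j < J, inner ℝ (g x j) (f x' - f x) + (y x' j - y x j) ≤ -τ) ∧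
      (D / D ^ ((3 / 4 : ℝ) ^ J) / 8 ^ J) ^ Module.finrank ℝ V ≤ Fintype.card ι := by
  induction J generalizing D with
  | zero =>
    refine ⟨Unit, inferInstance, fun _ => 0, fun _ _ => 0, fun _ _ => 0, ?_, ?_, ?_, ?_, ?_⟩
    · intro; rw [norm_zero]; positivity
    · intro _ _; rw [abs_zero]; positivity
    · simp
    · intro x x' h; exact absurd (Subsingleton.elim _ _) h
    · have : D ≠ 0 := by positivity
      simp [this]
  | succ J ih =>
    have hD0 : 0 < D := by linarith
    -- The cell scale `D'` must be far below `D` for the recursion to fit, yet `D' ^ 2 / D`, the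
    -- depth of the paraboloid's curvature over a distance `D'`, must still be large. Exponent `3/4`
    -- makes this depth `√D` up to a constant.
    set D' := D ^ (3 / 4 : ℝ) with hD'
    have hDD : D' ^ ((3 / 4 : ℝ) ^ J) = D ^ ((3 / 4 : ℝ) ^ (J + 1)) := by
      rw [hD', ← Real.rpow_mul hD0.le, pow_succ']
    have hD'1 : 1 ≤ D' := Real.one_le_rpow hD (by norm_num)
    have hle : D ^ ((3 / 4 : ℝ) ^ (J + 1)) ≤ D := by
      conv_rhs => rw [← Real.rpow_one D]
      exact Real.rpow_le_rpow_of_exponent_le hD (pow_le_one₀ (by norm_num) (by norm_num))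
    set q := D ^ (1 / 4 : ℝ) with hq
    have hq0 : 0 < q := Real.rpow_pos_of_pos hD0 _
    have hq4 : q ^ 4 = D := by
      rw [hq, ← Real.rpow_natCast, ← Real.rpow_mul hD0.le]; norm_num
    have hq3 : q ^ 3 = D' := by
      rw [hq, hD', ← Real.rpow_natCast, ← Real.rpow_mul hD0.le]; norm_num
    have hq2 : 2 ≤ q := by
      by_contra hlt
      have : q ^ 4 < 2 ^ 4 := pow_lt_pow_left₀ (not_le.1 hlt) hq0.le (by norm_num)
      linarith
    -- This makes the cells fit: coarse radius `D / 8` plus fine radius `D' / 4` is at most `D / 4`.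
    have hhalf : D' ≤ D / 2 := by
      rw [← hq3, ← hq4]
      nlinarith [pow_pos hq0 3]
    have hτq : 2 * τ ≤ q ^ 2 := by
      refine le_of_sq_le_sq ?_ (by positivity)
      nlinarith
    obtain ⟨ι, hι, f, y, g, hf, hy, hg, hsep, hcard⟩ := ih D' hD'1 (hDD ▸ h16) (hDD ▸ hτ)
    obtain ⟨P, hP1, hP2, hP3⟩ := exists_separated (V := V) (D / 8) D' (by positivity) (by positivity)
    let r : P × ι → V := fun x => x.1 + f x.2
    have hr : ∀ x, ‖r x‖ ≤ D / 4 := fun x => by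
      have h1 := norm_add_le (x.1 : V) (f x.2)
      have h2 := hP1 x.1 x.1.2
      have h3 := hf x.2
      have : ‖r x‖ ≤ ‖(x.1 : V)‖ + ‖f x.2‖ := h1
      linarith
    -- The new coordinate `J` is the height of the paraboloid `-(2/D)‖r‖²`, and `(4/D) r` is minus
    -- its gradient, of norm at most one because `‖r‖ ≤ D / 4`. The older coordinates are copied
    -- from the cell; they see only differences, so translating a cell by `p` is harmless.
    refine ⟨P × ι, inferInstance, r,
      fun x j => if j = J then -(2 / D) * ‖r x‖ ^ 2 else y x.2 j,
      fun x j => if j = J then (4 / D) • r x else g x.2 j, hr, ?_, ?_, ?_, ?_⟩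
    · intro x j
      beta_reduce
      by_cases hj : j = J
      · have h1 : ‖r x‖ ^ 2 ≤ (D / 4) ^ 2 := pow_le_pow_left₀ (norm_nonneg _) (hr x) 2
        rw [if_pos hj, abs_mul, abs_neg, abs_of_pos (by positivity), abs_of_nonneg (by positivity)]
        calc 2 / D * ‖r x‖ ^ 2 ≤ 2 / D * (D / 4) ^ 2 := by gcongr
          _ = D / 8 := by field_simp; norm_num
      · simp only [if_neg hj]
        linarith [hy x.2 j]
    · intro x j
      beta_reduce
      by_cases hj : j = J
      · rw [if_pos hj, norm_smul, Real.norm_of_nonneg (by positivity)]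
        calc 4 / D * ‖r x‖ ≤ 4 / D * (D / 4) := by gcongr; exact hr x
          _ = 1 := by field_simp
      · simp only [if_neg hj]; exact hg x.2 j
    · rintro ⟨p, x⟩ ⟨p', x'⟩ hne
      by_cases hp : p = p'
      · subst hp
        have hx : x ≠ x' := fun h => hne (by rw [h])
        obtain ⟨j, hj, h⟩ := hsep x x' hx
        refine ⟨j, by omega, ?_⟩
        simp only [if_neg hj.ne]
        have : r (p, x') - r (p, x) = f x' - f x := by simp [r]
        rwa [this]
      · refine ⟨J, by omega, ?_⟩
        simp only [if_true]
        set a := r (p, x)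
        set b := r (p', x')
        -- Centres are `D'` apart and each fine offset has norm at most `D' / 4`.
        have hab : D' / 2 ≤ ‖b - a‖ := by
          have h1 := hP2 p' p'.2 p p.2 fun h => hp (Subtype.ext h.symm)
          have h2 : (p' : V) - p = (b - a) - (f x' - f x) := by simp only [a, b, r]; abel
          have h3 := norm_sub_le (b - a) (f x' - f x)
          have h4 := norm_sub_le (f x') (f x)
          rw [← h2] at h3
          linarith [hf x, hf x']
        -- The gap between a paraboloid and its tangent plane is exactly quadratic, whatever the
        -- base point.
        have hin : inner ℝ ((4 / D) • a) (b - a) + (-(2 / D) * ‖b‖ ^ 2 - -(2 / D) * ‖a‖ ^ 2) =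
            -(2 / D) * ‖b - a‖ ^ 2 := by
          rw [norm_sub_sq_real, real_inner_smul_left, inner_sub_right, real_inner_self_eq_norm_sq,
            real_inner_comm]
          ring
        rw [hin]
        have h5 : (D' / 2) ^ 2 ≤ ‖b - a‖ ^ 2 := pow_le_pow_left₀ (by positivity) hab 2
        have h6 : τ ≤ 2 / D * (D' / 2) ^ 2 := by
          rw [← hq3, ← hq4]
          have : 2 / q ^ 4 * (q ^ 3 / 2) ^ 2 = q ^ 2 / 2 := by field_simp
          rw [this]; linarith
        have h7 : 2 / D * (D' / 2) ^ 2 ≤ 2 / D * ‖b - a‖ ^ 2 := by gcongr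
        linarith
    · rw [Fintype.card_prod, Fintype.card_coe, Nat.cast_mul]
      rw [hDD] at hcard
      refine le_trans (le_of_eq ?_) (mul_le_mul hP3 hcard (by positivity) (by positivity))
      rw [← mul_pow]
      congr 1
      have : D' ≠ 0 := by positivity
      field_simp
      rw [pow_succ']

end Code

/-! ### The trace against a received state -/

theorem inner_fockNumber {k : ℕ} (n : Fin k → ℕ) (v : Fock k) :
    inner ℂ (fockNumber n) v = v n := by
  simp [fockNumber, lp.inner_single_left]

theorem inner_fockNumber_right {k : ℕ} (n : Fin k → ℕ) (v : Fock k) :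
    inner ℂ v (fockNumber n) = conj (v n) := by
  rw [← inner_conj_symm, inner_fockNumber]

theorem hasSum_norm_sq {k : ℕ} (v : Fock k) :
    HasSum (fun n => ‖v n‖ ^ 2) (‖v‖ ^ 2) := by
  simpa using lp.hasSum_norm (p := 2) (by simp) v

/-- The law of the amplitudes in the coherent-state mixture `receivedState N α`. -/
noncomputable abbrev amplitudeLaw (N : ℝ≥0) {k : ℕ} (α : EuclideanSpace ℂ (Fin k)) :
    Measure (Fin k → ℂ) := Measure.pi fun i => complexGaussian (α i) N

/-- Every outcome probability becomes an average of coherent-state expectations. Sum and integral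
are exchanged by dominated convergence: moving `T` to its adjoint makes the sum over number states
Parseval's identity. -/
theorem trace_receivedState_mul (N : ℝ≥0) {k : ℕ} (α : EuclideanSpace ℂ (Fin k))
    (T : Fock k →L[ℂ] Fock k) :
    trace (receivedState N α * T) =
      ∫ z, inner ℂ (coherentProd z) (T (coherentProd z)) ∂(amplitudeLaw N α) := by
  have hterm : ∀ n : Fin k → ℕ,
      inner ℂ (fockNumber n) ((receivedState N α * T) (fockNumber n)) =
        ∫ z, inner ℂ (fockNumber n) (coherentProd z) *
          inner ℂ (coherentProd z) (T (fockNumber n)) ∂(amplitudeLaw N α) := fun n =>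
    inner_integral_proj (coherentProd (k := k)) continuous_coherentProd norm_coherentProd
      (amplitudeLaw N α) (fockNumber n) (T (fockNumber n))
  rw [trace, tsum_congr hterm]
  set S := ContinuousLinearMap.adjoint T
  have hc := continuous_coherentProd (k := k)
  have hS : ∀ n z, inner ℂ (fockNumber n) (coherentProd z) *
      inner ℂ (coherentProd z) (T (fockNumber n)) =
      inner ℂ (S (coherentProd z) n) (coherentProd z n) := fun n z => by
    rw [inner_fockNumber, ← ContinuousLinearMap.adjoint_inner_left, inner_fockNumber_right,
      RCLike.inner_apply]
  have hb : ∀ z : Fin k → ℂ, HasSum (fun n => ‖coherentProd z n‖ ^ 2 + ‖S (coherentProd z) n‖ ^ 2)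
      (‖coherentProd z‖ ^ 2 + ‖S (coherentProd z)‖ ^ 2) := fun z =>
    (hasSum_norm_sq _).add (hasSum_norm_sq _)
  refine (hasSum_integral_of_dominated_convergence
    (fun n z => ‖coherentProd z n‖ ^ 2 + ‖S (coherentProd z) n‖ ^ 2) ?_ ?_ ?_ ?_ ?_).tsum_eq
  · intro n
    have : Continuous fun z : Fin k → ℂ => inner ℂ (fockNumber n) (coherentProd z) *
      inner ℂ (coherentProd z) (T (fockNumber n)) := by fun_prop
    exact this.aestronglyMeasurable
  · intro n
    refine ae_of_all _ fun z => ?_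
    rw [hS]
    refine (norm_inner_le_norm _ _).trans ?_
    nlinarith [sq_nonneg (‖coherentProd z n‖ - ‖S (coherentProd z) n‖),
      sq_nonneg ‖coherentProd z n‖, sq_nonneg ‖S (coherentProd z) n‖]
  · exact ae_of_all _ fun z => (hb z).summable
  · simp only [fun z => (hb z).tsum_eq]
    refine Integrable.of_bound (C := 1 + ‖S‖ ^ 2) ?_ (ae_of_all _ fun z => ?_)
    · have : Continuous fun z : Fin k → ℂ => ‖coherentProd z‖ ^ 2 + ‖S (coherentProd z)‖ ^ 2 := by
        fun_prop
      exact this.aestronglyMeasurable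
    · rw [Real.norm_of_nonneg (by positivity), norm_coherentProd, one_pow]
      have := S.le_opNorm (coherentProd z)
      rw [norm_coherentProd, mul_one] at this
      gcongr
  · refine ae_of_all _ fun z => ?_
    simp only [hS]
    rw [← ContinuousLinearMap.adjoint_inner_left]
    exact lp.hasSum_inner _ _

/-! ### Orthogonality of number-state amplitudes of coherent states -/

theorem norm_sq_coherent_apply (z : ℂ) (n : ℕ) :
    ‖coherent z n‖ ^ 2 = ‖z‖ ^ (2 * n : ℝ) * Real.exp (-‖z‖ ^ (2 : ℝ)) * (n.factorial : ℝ)⁻¹ := by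
  have h1 : ‖Complex.exp (-(‖z‖ ^ 2 / 2 : ℝ))‖ = Real.exp (-(‖z‖ ^ 2 / 2)) := by
    rw [Complex.norm_exp]; norm_cast
  have h2 : ‖z‖ ^ (2 * n : ℝ) = ‖z‖ ^ (2 * n) := by
    rw [← Real.rpow_natCast]; push_cast; rfl
  rw [coherent_apply, norm_div, norm_mul, h1, norm_pow, Complex.norm_real,
    Real.norm_of_nonneg (Real.sqrt_nonneg _), div_pow, mul_pow, Real.sq_sqrt (by positivity), h2,
    ← Real.exp_nat_mul, Real.rpow_two, div_eq_mul_inv, pow_mul']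
  push_cast
  ring_nf

theorem integral_norm_sq_coherent (n : ℕ) : ∫ z : ℂ, ‖coherent z n‖ ^ 2 = Real.pi := by
  simp only [norm_sq_coherent_apply]
  rw [integral_mul_const,
    Complex.integral_rpow_mul_exp_neg_rpow (by norm_num) (by linarith [n.cast_nonneg (α := ℝ)])]
  have : ((2 * n + 2) / 2 : ℝ) = n + 1 := by ring
  rw [this, Real.Gamma_nat_eq_factorial]
  field_simp

theorem continuous_coherent_apply (n : ℕ) : Continuous fun z => coherent z n := by
  simp only [coherent_apply]
  fun_prop

theorem integrable_norm_sq_coherent (n : ℕ) : Integrable fun z : ℂ => ‖coherent z n‖ ^ 2 := by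
  -- A non-integrable function has integral zero by convention, which contradicts the value `π`.
  by_contra h
  have := integral_undef h
  rw [integral_norm_sq_coherent] at this
  exact Real.pi_ne_zero this

theorem integrable_coherent_mul (m n : ℕ) :
    Integrable fun z : ℂ => conj (coherent z m) * coherent z n := by
  refine ((integrable_norm_sq_coherent m).add (integrable_norm_sq_coherent n)).mono'
    ((Complex.continuous_conj.comp (continuous_coherent_apply m)).mul
      (continuous_coherent_apply n)).aestronglyMeasurable (ae_of_all _ fun z => ?_)
  rw [norm_mul, RCLike.norm_conj]
  simp only [Pi.add_apply]
  nlinarith [sq_nonneg (‖coherent z m‖ - ‖coherent z n‖), sq_nonneg ‖coherent z m‖,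
    sq_nonneg ‖coherent z n‖]

theorem coherent_rotation (a : Circle) (z : ℂ) (n : ℕ) :
    coherent (a * z) n = (a : ℂ) ^ n * coherent z n := by
  rw [coherent_apply, coherent_apply, norm_mul, Circle.norm_coe, one_mul, mul_pow]
  ring

/-- The Lebesgue measure is invariant under phase rotations, while the integrand picks up a phase of
exponent `n - m`. -/
theorem integral_coherent_mul (m n : ℕ) :
    ∫ z : ℂ, conj (coherent z m) * coherent z n = if m = n then (Real.pi : ℂ) else 0 := by
  split_ifs with h
  · subst h
    rw [← integral_norm_sq_coherent m, ← integral_complex_ofReal]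
    refine integral_congr_ae (ae_of_all _ fun z => ?_)
    simp only [Complex.conj_mul', Complex.ofReal_pow]
  · set I := ∫ z : ℂ, conj (coherent z m) * coherent z n with hI
    have hmn : ((n : ℝ) - m) ≠ 0 := sub_ne_zero.2 fun h' => h (Nat.cast_injective h').symm
    -- The angle `π / (n - m)` makes the acquired phase `-1`, so the integral equals its own
    -- negative.
    set a : Circle := Circle.exp (Real.pi / (n - m)) with ha
    have hrot : I = conj (a : ℂ) ^ m * (a : ℂ) ^ n * I := by
      have h1 := (rotation a).measurePreserving.integral_comp
        (rotation a).toHomeomorph.measurableEmbedding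
        fun z => conj (coherent z m) * coherent z n
      refine h1.symm.trans (Eq.trans ?_ (integral_const_mul _ _))
      refine integral_congr_ae (ae_of_all _ fun z => ?_)
      simp only [rotation_apply, coherent_rotation, map_mul, map_pow]
      ring
    have hphase : conj (a : ℂ) ^ m * (a : ℂ) ^ n = -1 := by
      rw [ha, Circle.coe_exp, ← Complex.exp_conj, ← Complex.exp_nat_mul, ← Complex.exp_nat_mul,
        ← Complex.exp_add, ← Complex.exp_pi_mul_I]
      congr 1
      have : ((n : ℂ) - m) ≠ 0 := by exact_mod_cast hmn
      simp only [map_mul, Complex.conj_ofReal, Complex.conj_I]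
      push_cast
      field_simp
      ring
    rw [hphase] at hrot
    have h2 : 2 * I = 0 := by linear_combination hrot
    simpa using h2

theorem integrable_coherentProd_mul {k : ℕ} (m n : Fin k → ℕ) :
    Integrable fun z : Fin k → ℂ => conj (coherentProd z m) * coherentProd z n := by
  have := Integrable.fintype_prod (μ := fun _ : Fin k => (volume : Measure ℂ))
    fun i => integrable_coherent_mul (m i) (n i)
  refine this.congr (ae_of_all _ fun z => ?_)
  simp [coherentProd, tensor_apply, Finset.prod_mul_distrib]

theorem integral_coherentProd_mul {k : ℕ} (m n : Fin k → ℕ) :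
    ∫ z : Fin k → ℂ, conj (coherentProd z m) * coherentProd z n =
      if m = n then (Real.pi : ℂ) ^ k else 0 := by
  have h := integral_fintype_prod_volume_eq_prod
    (fun (i : Fin k) (z : ℂ) => conj (coherent z (m i)) * coherent z (n i))
  simp only [integral_coherent_mul] at h
  have h2 : ∫ z : Fin k → ℂ, conj (coherentProd z m) * coherentProd z n =
      ∫ z : Fin k → ℂ, ∏ i, (conj (coherent (z i) (m i)) * coherent (z i) (n i)) := by
    refine integral_congr_ae (ae_of_all _ fun z => ?_)
    simp [coherentProd, tensor_apply, Finset.prod_mul_distrib]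
  rw [h2, h]
  split_ifs with hmn
  · simp [hmn]
  · obtain ⟨i, hi⟩ := Function.ne_iff.1 hmn
    exact Finset.prod_eq_zero (Finset.mem_univ i) (if_neg hi)

/-- The resolution of the identity by coherent states, as an upper bound on a bounded region and
for finitely supported vectors. -/
theorem setIntegral_norm_sq_inner_le_of_finset {k : ℕ} (A : Set (Fin k → ℂ)) (v : Fock k)
    (s : Finset (Fin k → ℕ)) :
    ∫ z in A, ‖inner ℂ (coherentProd z) (∑ n ∈ s, lp.single 2 n (v n) : Fock k)‖ ^ 2 ≤
      Real.pi ^ k * ‖v‖ ^ 2 := by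
  have hexp : ∀ z : Fin k → ℂ,
      ((‖inner ℂ (coherentProd z) (∑ n ∈ s, lp.single 2 n (v n) : Fock k)‖ ^ 2 : ℝ) : ℂ) =
      ∑ m ∈ s, ∑ n ∈ s, v m * conj (v n) * (conj (coherentProd z m) * coherentProd z n) := by
    intro z
    rw [Complex.ofReal_pow, ← Complex.mul_conj', inner_sum, map_sum, Finset.sum_mul_sum]
    refine Finset.sum_congr rfl fun m _ => Finset.sum_congr rfl fun n _ => ?_
    simp only [lp.inner_single_right, RCLike.inner_apply, map_mul, Complex.conj_conj]
    ring
  have hint : ∀ m n : Fin k → ℕ, Integrable fun z : Fin k → ℂ =>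
      v m * conj (v n) * (conj (coherentProd z m) * coherentProd z n) := fun m n =>
    (integrable_coherentProd_mul m n).const_mul _
  have hintC : Integrable fun z : Fin k → ℂ =>
      ((‖inner ℂ (coherentProd z) (∑ n ∈ s, lp.single 2 n (v n) : Fock k)‖ ^ 2 : ℝ) : ℂ) := by
    simp only [hexp]
    exact integrable_finsetSum _ fun m _ => integrable_finsetSum _ fun n _ => hint m n
  have hintR : Integrable fun z : Fin k → ℂ =>
      ‖inner ℂ (coherentProd z) (∑ n ∈ s, lp.single 2 n (v n) : Fock k)‖ ^ 2 := by
    exact hintC.re.congr (ae_of_all _ fun z => Complex.ofReal_re _)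
  have htot : ∫ z : Fin k → ℂ,
      ‖inner ℂ (coherentProd z) (∑ n ∈ s, lp.single 2 n (v n) : Fock k)‖ ^ 2 =
      Real.pi ^ k * ∑ n ∈ s, ‖v n‖ ^ 2 := by
    refine Complex.ofReal_injective ?_
    rw [← integral_complex_ofReal]
    simp only [hexp]
    rw [integral_finsetSum _ fun m _ => integrable_finsetSum _ fun n _ => hint m n]
    have : ∀ m ∈ s, ∫ z : Fin k → ℂ, ∑ n ∈ s,
        v m * conj (v n) * (conj (coherentProd z m) * coherentProd z n) =
        (Real.pi : ℂ) ^ k * ((‖v m‖ ^ 2 : ℝ) : ℂ) := fun m hm => by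
      rw [integral_finsetSum _ fun n _ => hint m n]
      simp only [integral_const_mul, integral_coherentProd_mul, mul_ite, mul_zero]
      rw [Finset.sum_ite_eq, if_pos hm, Complex.mul_conj']
      push_cast
      ring
    rw [Finset.sum_congr rfl this, ← Finset.mul_sum]
    push_cast
    rfl
  calc _ ≤ ∫ z : Fin k → ℂ,
        ‖inner ℂ (coherentProd z) (∑ n ∈ s, lp.single 2 n (v n) : Fock k)‖ ^ 2 :=
      setIntegral_le_integral hintR (ae_of_all _ fun z => by positivity)
    _ = Real.pi ^ k * ∑ n ∈ s, ‖v n‖ ^ 2 := htot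
    _ ≤ _ := by
      gcongr
      exact sum_le_hasSum s (fun n _ => by positivity) (hasSum_norm_sq v)

/-! ### Heterodyne detection -/

/-- The operator of the event that heterodyne detection yields an amplitude in `A`. -/
noncomputable def heterodyne {k : ℕ} (A : Set (Fin k → ℂ)) : Fock k →L[ℂ] Fock k :=
  ((Real.pi ^ k : ℝ)⁻¹ : ℂ) • ∫ z in A, proj (coherentProd z)

/-- The projectors have norm one, so the operator-valued integral converges in norm when `A` has
finite volume. This is why the acceptance regions below are made bounded. -/
theorem inner_heterodyne {k : ℕ} (A : Set (Fin k → ℂ)) (hA : volume A ≠ ∞) (v : Fock k) :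
    inner ℂ v (heterodyne A v) =
      (((Real.pi ^ k)⁻¹ * ∫ z in A, ‖inner ℂ (coherentProd z) v‖ ^ 2 : ℝ) : ℂ) := by
  have : IsFiniteMeasure (volume.restrict A) := ⟨by simpa using hA.lt_top⟩
  have h : inner ℂ v ((∫ z in A, proj (coherentProd z)) v) =
      ∫ z in A, inner ℂ v (coherentProd z) * inner ℂ (coherentProd z) v :=
    inner_integral_proj (coherentProd (k := k)) continuous_coherentProd norm_coherentProd
      (volume.restrict A) v v
  rw [heterodyne, smul_apply, inner_smul_right, h, Complex.ofReal_mul,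
    ← integral_complex_ofReal]
  push_cast
  congr 1
  refine integral_congr_ae (ae_of_all _ fun z => ?_)
  simp only
  rw [← inner_conj_symm v, Complex.conj_mul']

/-- Finitely supported vectors are dense, and the left side is a continuous function of the vector
because it is a quadratic form of the bounded operator `heterodyne A`. -/
theorem setIntegral_norm_sq_inner_le {k : ℕ} (A : Set (Fin k → ℂ)) (hA : volume A ≠ ∞)
    (v : Fock k) : ∫ z in A, ‖inner ℂ (coherentProd z) v‖ ^ 2 ≤ Real.pi ^ k * ‖v‖ ^ 2 := by
  have hpi : (0 : ℝ) < Real.pi ^ k := by positivity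
  have key : ∀ w : Fock k, ∫ z in A, ‖inner ℂ (coherentProd z) w‖ ^ 2 =
      Real.pi ^ k * (inner ℂ w (heterodyne A w)).re := fun w => by
    rw [inner_heterodyne A hA, Complex.ofReal_re, mul_inv_cancel_left₀ hpi.ne']
  have hsum : Tendsto (fun s : Finset (Fin k → ℕ) => (∑ n ∈ s, lp.single 2 n (v n) : Fock k))
      atTop (𝓝 v) := lp.hasSum_single (p := 2) (by simp) v
  have hcont : Continuous fun w : Fock k => Real.pi ^ k * (inner ℂ w (heterodyne A w)).re := by
    fun_prop
  rw [key]
  refine le_of_tendsto ((hcont.tendsto v).comp hsum) (Eventually.of_forall fun s => ?_)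
  have := setIntegral_norm_sq_inner_le_of_finset A v s
  rwa [key] at this

theorem nonneg_of_inner {E : Type*} [NormedAddCommGroup E] [InnerProductSpace ℂ E]
    [CompleteSpace E] (T : E →L[ℂ] E) (r : E → ℝ) (hr : ∀ v, inner ℂ v (T v) = r v)
    (h0 : ∀ v, 0 ≤ r v) : 0 ≤ T := by
  rw [ContinuousLinearMap.nonneg_iff_isPositive, ContinuousLinearMap.isPositive_iff_complex]
  intro v
  have : inner ℂ (T v) v = (r v : ℂ) := by rw [← inner_conj_symm, hr, Complex.conj_ofReal]
  simp [this, h0 v]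

theorem heterodyne_nonneg {k : ℕ} (A : Set (Fin k → ℂ)) (hA : volume A ≠ ∞) :
    0 ≤ heterodyne A :=
  nonneg_of_inner _ _ (inner_heterodyne A hA) fun v =>
    mul_nonneg (by positivity) (integral_nonneg fun z => by positivity)

theorem heterodyne_le_one {k : ℕ} (A : Set (Fin k → ℂ)) (hA : volume A ≠ ∞) :
    heterodyne A ≤ 1 := by
  rw [← sub_nonneg]
  refine nonneg_of_inner _
    (fun v => ‖v‖ ^ 2 - (Real.pi ^ k)⁻¹ * ∫ z in A, ‖inner ℂ (coherentProd z) v‖ ^ 2)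
    (fun v => ?_) fun v => ?_
  · rw [sub_apply, inner_sub_right, inner_heterodyne A hA,
      one_apply_eq_self, inner_self_eq_norm_sq_to_K]
    push_cast
    rfl
  · rw [sub_nonneg, inv_mul_le_iff₀ (by positivity)]
    exact setIntegral_norm_sq_inner_le A hA v

theorem norm_inner_coherent_sq (z w : ℂ) :
    ‖inner ℂ (coherent z) (coherent w)‖ ^ 2 = Real.exp (-‖z - w‖ ^ 2) := by
  rw [inner_coherent, Complex.norm_exp, ← Real.exp_nat_mul]
  congr 1
  rw [← Complex.normSq_eq_norm_sq, ← Complex.normSq_eq_norm_sq, ← Complex.normSq_eq_norm_sq]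
  simp only [Complex.normSq_apply, Complex.add_re, Complex.sub_re, Complex.sub_im, Complex.neg_re,
    Complex.ofReal_re, Complex.mul_re, Complex.conj_re, Complex.conj_im]
  push_cast
  ring

theorem norm_inner_coherentProd_sq {k : ℕ} (z w : Fin k → ℂ) :
    ‖inner ℂ (coherentProd z) (coherentProd w)‖ ^ 2 = Real.exp (-∑ i, ‖z i - w i‖ ^ 2) := by
  rw [coherentProd, coherentProd, inner_tensor, norm_prod, ← Finset.prod_pow,
    ← Finset.sum_neg_distrib, Real.exp_sum]
  exact Finset.prod_congr rfl fun i _ => norm_inner_coherent_sq _ _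

/-! ### Exponential moments -/

theorem integrable_exp_inner_complexGaussian (α u : ℂ) (N : ℝ≥0) :
    Integrable (fun w : ℂ => Real.exp (inner ℝ u w)) (complexGaussian α N) := by
  rw [complexGaussian, integrable_map_equiv]
  refine ((integrable_exp_mul_gaussianReal (μ := α.re) (v := N / 2) u.re).mul_prod
    (integrable_exp_mul_gaussianReal (μ := α.im) (v := N / 2) u.im)).congr
      (ae_of_all _ fun x => ?_)
  simp [← Real.exp_add, Complex.inner, Complex.measurableEquivRealProd_symm_apply, mul_comm]

theorem integral_exp_inner_complexGaussian (α u : ℂ) (N : ℝ≥0) :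
    ∫ w, Real.exp (inner ℝ u w) ∂(complexGaussian α N) =
      Real.exp (inner ℝ u α + N * ‖u‖ ^ 2 / 4) := by
  rw [complexGaussian, integral_map_equiv]
  have h : ∀ x : ℝ × ℝ, Real.exp (inner ℝ u (Complex.measurableEquivRealProd.symm x)) =
      Real.exp (u.re * x.1) * Real.exp (u.im * x.2) := fun x => by
    simp [← Real.exp_add, Complex.inner, Complex.measurableEquivRealProd_symm_apply, mul_comm]
  have h1 := fun (m : ℝ) (t : ℝ) => congrFun (mgf_fun_id_gaussianReal (μ := m) (v := N / 2)) t
  simp only [mgf] at h1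
  simp only [h]
  rw [integral_prod_mul (fun x => Real.exp (u.re * x)) fun x => Real.exp (u.im * x), h1, h1,
    ← Real.exp_add, ← Complex.normSq_eq_norm_sq, Complex.normSq_apply, Complex.inner]
  congr 1
  simp only [Complex.mul_re, Complex.conj_re, Complex.conj_im, NNReal.coe_div, NNReal.coe_ofNat]
  ring

theorem integral_exp_neg_norm_sq_add_inner (u : ℂ) :
    ∫ z : ℂ, Real.exp (-‖z‖ ^ 2 + inner ℝ u z) = Real.pi * Real.exp (‖u‖ ^ 2 / 4) := by
  have h := GaussianFourier.integral_cexp_neg_mul_sq_norm_add (V := ℂ) (b := 1) (by simp) 1 u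
  refine Complex.ofReal_injective ?_
  rw [← integral_complex_ofReal]
  simp only [Complex.finrank_real_complex] at h
  simp only [Complex.ofReal_exp, Complex.ofReal_mul, Complex.ofReal_add, Complex.ofReal_neg,
    Complex.ofReal_pow, Complex.ofReal_div, Complex.ofReal_ofNat]
  convert! h using 1
  · simp
  · simp

theorem integral_exp_inner_sub_norm_sq (u w : ℂ) :
    ∫ z : ℂ, Real.exp (inner ℝ u z) * Real.exp (-‖z - w‖ ^ 2) =
      Real.pi * Real.exp (inner ℝ u w + ‖u‖ ^ 2 / 4) := by
  have h := integral_sub_right_eq_self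
    (fun z : ℂ => Real.exp (-‖z‖ ^ 2 + inner ℝ u z)) w (μ := volume)
  rw [integral_exp_neg_norm_sq_add_inner] at h
  rw [Real.exp_add, mul_left_comm, ← h, ← integral_const_mul]
  refine integral_congr_ae (ae_of_all _ fun z => ?_)
  simp only [inner_sub_right]
  rw [← Real.exp_add, ← Real.exp_add]
  ring_nf

theorem integrable_exp_inner_sub_norm_sq (u w : ℂ) :
    Integrable fun z : ℂ => Real.exp (inner ℝ u z) * Real.exp (-‖z - w‖ ^ 2) := by
  by_contra h
  have := integral_undef h
  rw [integral_exp_inner_sub_norm_sq] at this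
  exact (by positivity : Real.pi * Real.exp (inner ℝ u w + ‖u‖ ^ 2 / 4) ≠ 0) this

/-- The real-linear functional on `ℂ^k` with coefficient vector `u`. -/
noncomputable def linForm {k : ℕ} (u z : Fin k → ℂ) : ℝ := ∑ i, inner ℝ (u i) (z i)

/-- The squared Euclidean norm on `ℂ^k`. -/
noncomputable def normSq {k : ℕ} (z : Fin k → ℂ) : ℝ := ∑ i, ‖z i‖ ^ 2

theorem linForm_neg_left {k : ℕ} (u z : Fin k → ℂ) : linForm (-u) z = -linForm u z := by
  simp only [linForm, Pi.neg_apply, inner_neg_left, Finset.sum_neg_distrib]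

theorem continuous_linForm {k : ℕ} (u : Fin k → ℂ) : Continuous (linForm u) := by
  unfold linForm
  fun_prop

theorem normSq_neg {k : ℕ} (u : Fin k → ℂ) : normSq (-u) = normSq u := by simp [normSq]

theorem integrable_exp_linForm_amplitudeLaw {k : ℕ} (α : EuclideanSpace ℂ (Fin k))
    (u : Fin k → ℂ) (N : ℝ≥0) :
    Integrable (fun w => Real.exp (linForm u w)) (amplitudeLaw N α) := by
  simp only [linForm, Real.exp_sum]
  exact Integrable.fintype_prod fun i => integrable_exp_inner_complexGaussian _ _ _

theorem integral_exp_linForm_amplitudeLaw {k : ℕ} (α : EuclideanSpace ℂ (Fin k))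
    (u : Fin k → ℂ) (N : ℝ≥0) :
    ∫ w, Real.exp (linForm u w) ∂(amplitudeLaw N α) =
      Real.exp (linForm u α + N * normSq u / 4) := by
  simp only [linForm, Real.exp_sum]
  rw [integral_fintype_prod_eq_prod fun i w => Real.exp (inner ℝ (u i) w)]
  simp only [integral_exp_inner_complexGaussian]
  rw [← Real.exp_sum, Finset.sum_add_distrib, normSq, Finset.mul_sum, Finset.sum_div]

/-- The density (up to the factor `π ^ k`) of the heterodyne outcome in a coherent state. -/
noncomputable def husimi {k : ℕ} (w z : Fin k → ℂ) : ℝ := Real.exp (-normSq (z - w))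

theorem exp_linForm_mul_husimi {k : ℕ} (u w z : Fin k → ℂ) :
    Real.exp (linForm u z) * husimi w z =
      ∏ i, (Real.exp (inner ℝ (u i) (z i)) * Real.exp (-‖z i - w i‖ ^ 2)) := by
  simp [linForm, husimi, normSq, Real.exp_sum, Finset.prod_mul_distrib,
    ← Finset.sum_neg_distrib]

theorem integrable_exp_linForm_mul_husimi {k : ℕ} (u w : Fin k → ℂ) :
    Integrable fun z => Real.exp (linForm u z) * husimi w z := by
  simp only [exp_linForm_mul_husimi]
  exact Integrable.fintype_prod (μ := fun _ : Fin k => (volume : Measure ℂ))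
    fun i => integrable_exp_inner_sub_norm_sq (u i) (w i)

theorem integral_exp_linForm_mul_husimi {k : ℕ} (u w : Fin k → ℂ) :
    ∫ z, Real.exp (linForm u z) * husimi w z =
      Real.pi ^ k * Real.exp (linForm u w + normSq u / 4) := by
  simp only [exp_linForm_mul_husimi]
  rw [integral_fintype_prod_volume_eq_prod
    fun i z => Real.exp (inner ℝ (u i) z) * Real.exp (-‖z - w i‖ ^ 2)]
  simp only [integral_exp_inner_sub_norm_sq]
  rw [Finset.prod_mul_distrib, ← Real.exp_sum, Finset.sum_add_distrib, Finset.prod_const,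
    Finset.card_univ, Fintype.card_fin, linForm, normSq, Finset.sum_div]

theorem husimi_pos {k : ℕ} (w z : Fin k → ℂ) : 0 < husimi w z := Real.exp_pos _

theorem linForm_zero_left {k : ℕ} (z : Fin k → ℂ) : linForm 0 z = 0 := by simp [linForm]

theorem integrable_husimi {k : ℕ} (w : Fin k → ℂ) : Integrable (husimi w) := by
  simpa [linForm_zero_left] using integrable_exp_linForm_mul_husimi 0 w

theorem integral_husimi {k : ℕ} (w : Fin k → ℂ) : ∫ z, husimi w z = Real.pi ^ k := by
  simpa [linForm_zero_left, normSq] using integral_exp_linForm_mul_husimi 0 w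

/-! ### Error probabilities of heterodyne tests -/

/-- The probability of the heterodyne event `A` in a coherent product state. -/
noncomputable def heterodyneProb {k : ℕ} (A : Set (Fin k → ℂ)) (w : Fin k → ℂ) : ℝ :=
  (Real.pi ^ k)⁻¹ * ∫ z in A, husimi w z

theorem inner_heterodyne_coherentProd {k : ℕ} (A : Set (Fin k → ℂ)) (hA : volume A ≠ ∞)
    (w : Fin k → ℂ) : inner ℂ (coherentProd w) (heterodyne A (coherentProd w)) =
      (heterodyneProb A w : ℂ) := by
  rw [inner_heterodyne A hA, heterodyneProb]
  simp only [norm_inner_coherentProd_sq, husimi, normSq, Pi.sub_apply]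

theorem re_trace_heterodyne {k : ℕ} (N : ℝ≥0) (α : EuclideanSpace ℂ (Fin k))
    (A : Set (Fin k → ℂ)) (hA : volume A ≠ ∞) :
    (trace (receivedState N α * heterodyne A)).re =
      ∫ w, heterodyneProb A w ∂(amplitudeLaw N α) := by
  rw [trace_receivedState_mul]
  simp only [inner_heterodyne_coherentProd A hA]
  rw [integral_complex_ofReal, Complex.ofReal_re]

theorem integrable_heterodyneProb {k : ℕ} (N : ℝ≥0) (α : EuclideanSpace ℂ (Fin k))
    (A : Set (Fin k → ℂ)) (hA : volume A ≠ ∞) :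
    Integrable (heterodyneProb A) (amplitudeLaw N α) := by
  have hc : Continuous (heterodyneProb A) := by
    have h : heterodyneProb A = fun w =>
        (inner ℂ (coherentProd w) (heterodyne A (coherentProd w))).re := by
      funext w; rw [inner_heterodyne_coherentProd A hA, Complex.ofReal_re]
    rw [h]
    have := continuous_coherentProd (k := k)
    fun_prop
  refine Integrable.of_bound hc.aestronglyMeasurable 1 (ae_of_all _ fun w => ?_)
  have h0 : 0 ≤ ∫ z in A, husimi w z := integral_nonneg fun z => (husimi_pos w z).le
  rw [heterodyneProb, Real.norm_of_nonneg (by positivity), inv_mul_le_iff₀ (by positivity),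
    mul_one, ← integral_husimi w]
  exact setIntegral_le_integral (integrable_husimi w) (ae_of_all _ fun z => (husimi_pos w z).le)

/-- A heterodyne event contained in a half-space is unlikely for signals far outside. -/
theorem re_trace_heterodyne_le {k : ℕ} (N : ℝ≥0) (β : EuclideanSpace ℂ (Fin k))
    (A : Set (Fin k → ℂ)) (hA : volume A ≠ ∞) (hAm : MeasurableSet A) (u : Fin k → ℂ) (c : ℝ)
    (hu : ∀ z ∈ A, c ≤ linForm u z) :
    (trace (receivedState N β * heterodyne A)).re ≤
      Real.exp (linForm u β - c + (N + 1) * normSq u / 4) := by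
  rw [re_trace_heterodyne N β A hA]
  -- Chernoff bound with parameter one: the indicator of `A` is at most `exp (linForm u z - c)`. The
  -- detection noise contributes `normSq u / 4` to the exponent; the thermal noise, averaged
  -- afterwards, contributes `N` times as much.
  have hw : ∀ w, heterodyneProb A w ≤ Real.exp (-c + normSq u / 4) * Real.exp (linForm u w) := by
    intro w
    rw [heterodyneProb, inv_mul_le_iff₀ (by positivity)]
    have hi := (integrable_exp_linForm_mul_husimi u w).const_mul (Real.exp (-c))
    calc ∫ z in A, husimi w z
        ≤ ∫ z in A, Real.exp (-c) * (Real.exp (linForm u z) * husimi w z) := by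
          refine setIntegral_mono_on (integrable_husimi w).integrableOn hi.integrableOn hAm
            fun z hz => ?_
          rw [← mul_assoc, ← Real.exp_add]
          refine le_mul_of_one_le_left (husimi_pos w z).le (Real.one_le_exp ?_)
          linarith [hu z hz]
      _ ≤ ∫ z, Real.exp (-c) * (Real.exp (linForm u z) * husimi w z) :=
          setIntegral_le_integral hi (ae_of_all _ fun z =>
            mul_nonneg (Real.exp_pos _).le (mul_nonneg (Real.exp_pos _).le (husimi_pos w z).le))
      _ = _ := by
          rw [integral_const_mul, integral_exp_linForm_mul_husimi, mul_left_comm, ← Real.exp_add,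
            ← Real.exp_add]
          ring_nf
  refine (integral_mono (integrable_heterodyneProb N β A hA)
    ((integrable_exp_linForm_amplitudeLaw β u N).const_mul _) hw).trans_eq ?_
  rw [integral_const_mul, integral_exp_linForm_amplitudeLaw, ← Real.exp_add]
  ring_nf

/-- The polyhedron of the outcomes `z` with `linForm (u j) (z - α) ≥ -t` for all `j`. -/
def polyhedron {k : ℕ} {κ : Type*} (u : κ → Fin k → ℂ) (α : Fin k → ℂ) (t : ℝ) :
    Set (Fin k → ℂ) := {z | ∀ j, linForm (u j) α - t ≤ linForm (u j) z}

theorem measurableSet_polyhedron {k : ℕ} {κ : Type*} (u : κ → Fin k → ℂ) (α : Fin k → ℂ) (t : ℝ) :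
    MeasurableSet (polyhedron u α t) := by
  have : IsClosed (polyhedron u α t) := by
    simp only [polyhedron, Set.ofPred_forall]
    exact isClosed_iInter fun j => isClosed_le continuous_const (continuous_linForm _)
  exact this.measurableSet

/-- Union bound over the faces: an outcome outside the polyhedron violates some inequality by more
than the margin `t`, and each violation is controlled by the Chernoff bound in direction `-u j`. -/
theorem one_sub_re_trace_heterodyne_polyhedron_le {k : ℕ} {κ : Type*} [Fintype κ] (N : ℝ≥0)
    (α : EuclideanSpace ℂ (Fin k)) (u : κ → Fin k → ℂ) (t : ℝ)
    (hA : volume (polyhedron u α t) ≠ ∞) :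
    1 - (trace (receivedState N α * heterodyne (polyhedron u α t))).re ≤
      ∑ j, Real.exp (-t + (N + 1) * normSq (u j) / 4) := by
  rw [re_trace_heterodyne N α _ hA]
  set A := polyhedron u α t
  have hAm : MeasurableSet A := measurableSet_polyhedron u α t
  let F : (Fin k → ℂ) → κ → (Fin k → ℂ) → ℝ := fun w j z =>
    Real.exp (linForm (u j) α - t) * (Real.exp (linForm (-u j) z) * husimi w z)
  have hF0 : ∀ w j z, 0 ≤ F w j z := fun w j z =>
    mul_nonneg (Real.exp_pos _).le (mul_nonneg (Real.exp_pos _).le (husimi_pos w z).le)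
  have hFi : ∀ w j, Integrable (F w j) := fun w j =>
    (integrable_exp_linForm_mul_husimi (-u j) w).const_mul _
  have hw : ∀ w, 1 - heterodyneProb A w ≤
      ∑ j, Real.exp (linForm (u j) α - t + normSq (u j) / 4) * Real.exp (linForm (-u j) w) := by
    intro w
    have h1 : Real.pi ^ k * (1 - heterodyneProb A w) = ∫ z in Aᶜ, husimi w z := by
      rw [mul_sub, mul_one, heterodyneProb, mul_inv_cancel_left₀ (by positivity),
        ← integral_husimi w, ← integral_add_compl hAm (integrable_husimi w), add_sub_cancel_left]
    rw [← mul_le_mul_iff_right₀ (show (0 : ℝ) < Real.pi ^ k by positivity), h1]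
    have hi : Integrable fun z => ∑ j, F w j z := integrable_finsetSum _ fun j _ => hFi w j
    calc ∫ z in Aᶜ, husimi w z ≤ ∫ z in Aᶜ, ∑ j, F w j z := by
          refine setIntegral_mono_on (integrable_husimi w).integrableOn hi.integrableOn hAm.compl
            fun z hz => ?_
          obtain ⟨j, hj⟩ : ∃ j, linForm (u j) z < linForm (u j) α - t := by
            by_contra hc
            push Not at hc
            exact hz hc
          refine le_trans ?_ (Finset.single_le_sum (fun j _ => hF0 w j z) (Finset.mem_univ j))
          simp only [F]
          rw [← mul_assoc, ← Real.exp_add]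
          refine le_mul_of_one_le_left (husimi_pos w z).le (Real.one_le_exp ?_)
          rw [linForm_neg_left]
          linarith
      _ ≤ ∫ z, ∑ j, F w j z :=
          setIntegral_le_integral hi (ae_of_all _ fun z => Finset.sum_nonneg fun j _ => hF0 w j z)
      _ = _ := by
          rw [integral_finsetSum _ fun j _ => hFi w j, Finset.mul_sum]
          refine Finset.sum_congr rfl fun j _ => ?_
          simp only [F]
          rw [integral_const_mul, integral_exp_linForm_mul_husimi, mul_left_comm, ← Real.exp_add,
            ← Real.exp_add, normSq_neg]
          ring_nf
  have h2 : 1 - ∫ w, heterodyneProb A w ∂(amplitudeLaw N α) =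
      ∫ w, (1 - heterodyneProb A w) ∂(amplitudeLaw N α) := by
    rw [integral_sub (integrable_const _) (integrable_heterodyneProb N α A hA)]
    simp
  have hi2 := fun j => (integrable_exp_linForm_amplitudeLaw α (-u j) N).const_mul
    (Real.exp (linForm (u j) α - t + normSq (u j) / 4))
  rw [h2]
  refine (integral_mono ((integrable_const _).sub (integrable_heterodyneProb N α A hA))
    (integrable_finsetSum _ fun j _ => hi2 j) hw).trans_eq ?_
  rw [integral_finsetSum _ fun j _ => hi2 j]
  refine Finset.sum_congr rfl fun j _ => ?_
  rw [integral_const_mul, integral_exp_linForm_amplitudeLaw, ← Real.exp_add, linForm_neg_left,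
    normSq_neg]
  ring_nf

/-! ### Distinguishability of close signals -/

theorem norm_inner_sub_inner_le {E : Type*} [NormedAddCommGroup E] [InnerProductSpace ℂ E]
    (T : E →L[ℂ] E) (hT : ‖T‖ ≤ 1) (u v : E) (hu : ‖u‖ = 1) (hv : ‖v‖ = 1) :
    ‖inner ℂ u (T u) - inner ℂ v (T v)‖ ≤ 2 * ‖u - v‖ := by
  have h : inner ℂ u (T u) - inner ℂ v (T v) =
      inner ℂ (u - v) (T u) + inner ℂ v (T (u - v)) := by
    rw [map_sub, inner_sub_left, inner_sub_right]; ring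
  have hTb : ∀ x, ‖T x‖ ≤ ‖x‖ := fun x => by
    simpa using T.le_of_opNorm_le hT x
  rw [h]
  refine (norm_add_le _ _).trans ?_
  have h1 := norm_inner_le_norm (𝕜 := ℂ) (u - v) (T u)
  have h2 := norm_inner_le_norm (𝕜 := ℂ) v (T (u - v))
  rw [hv, one_mul] at h2
  have h3 : ‖u - v‖ * ‖T u‖ ≤ ‖u - v‖ * 1 := by
    gcongr
    exact (hTb u).trans_eq hu
  linarith [hTb (u - v)]

/-- The expectation does not see the phase of `v`, so `v` can be rotated to make the overlap real
and nonnegative, which minimises the distance to `u`. -/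
theorem norm_inner_sub_inner_le_of_overlap {E : Type*} [NormedAddCommGroup E]
    [InnerProductSpace ℂ E] (T : E →L[ℂ] E) (hT : ‖T‖ ≤ 1) (u v : E) (hu : ‖u‖ = 1)
    (hv : ‖v‖ = 1) :
    ‖inner ℂ u (T u) - inner ℂ v (T v)‖ ≤ 2 * √(2 - 2 * ‖inner ℂ u v‖) := by
  obtain ⟨c, hc1, hc⟩ : ∃ c : ℂ, ‖c‖ = 1 ∧ inner ℂ u v * c = ‖inner ℂ u v‖ := by
    by_cases h0 : inner ℂ u v = 0
    · exact ⟨1, by simp, by simp [h0]⟩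
    · have h1 : (‖inner ℂ u v‖ : ℂ) ≠ 0 := by simpa using h0
      refine ⟨conj (inner ℂ u v) / ‖inner ℂ u v‖, ?_, ?_⟩
      · rw [norm_div, RCLike.norm_conj, Complex.norm_real, norm_norm, div_self]
        simpa using h0
      · rw [← mul_div_assoc, Complex.mul_conj', sq, mul_div_assoc, div_self h1, mul_one]
  have hcv : ‖c • v‖ = 1 := by rw [norm_smul, hc1, hv, one_mul]
  have h := norm_inner_sub_inner_le T hT u (c • v) hu hcv
  have h2 : inner ℂ (c • v) (T (c • v)) = inner ℂ v (T v) := by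
    rw [map_smul, inner_smul_left, inner_smul_right, ← mul_assoc, Complex.conj_mul', hc1]
    simp
  have h3 : ‖u - c • v‖ = √(2 - 2 * ‖inner ℂ u v‖) := by
    rw [← Real.sqrt_sq (norm_nonneg (u - c • v)), norm_sub_sq (𝕜 := ℂ), hu, hcv,
      inner_smul_right, mul_comm c, hc]
    congr 1
    simp only [RCLike.re_to_complex, Complex.ofReal_re]
    ring
  rwa [h2, h3] at h

theorem norm_inner_coherentProd_sub_le {k : ℕ} (T : Fock k →L[ℂ] Fock k) (hT : ‖T‖ ≤ 1)
    (z w : Fin k → ℂ) :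
    ‖inner ℂ (coherentProd z) (T (coherentProd z)) -
      inner ℂ (coherentProd w) (T (coherentProd w))‖ ≤ 2 * √(∑ i, ‖z i - w i‖ ^ 2) := by
  refine (norm_inner_sub_inner_le_of_overlap T hT _ _ (norm_coherentProd z)
    (norm_coherentProd w)).trans ?_
  gcongr
  set s := ∑ i, ‖z i - w i‖ ^ 2
  have h : ‖inner ℂ (coherentProd z) (coherentProd w)‖ = Real.exp (-s / 2) := by
    refine (pow_left_inj₀ (norm_nonneg _) (Real.exp_pos _).le two_ne_zero).1 ?_
    rw [norm_inner_coherentProd_sq, ← Real.exp_nat_mul]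
    congr 1
    push_cast
    ring
  rw [h]
  -- From `1 - s / 2 ≤ exp (-s / 2)` one gets `2 - 2 exp (-s / 2) ≤ s`.
  linarith [Real.add_one_le_exp (-s / 2)]

theorem complexGaussian_eq_map (α : ℂ) (N : ℝ≥0) :
    complexGaussian α N = (complexGaussian 0 N).map (fun z => z + α) := by
  have h1 : ∀ m : ℝ, gaussianReal m (N / 2) = (gaussianReal 0 (N / 2)).map (· + m) := fun m => by
    rw [gaussianReal_map_add_const, zero_add]
  rw [complexGaussian, complexGaussian, Measure.map_map (by fun_prop)
    (MeasurableEquiv.measurable _), h1 α.re, h1 α.im, Measure.map_prod_map _ _ (by fun_prop)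
    (by fun_prop), Measure.map_map (MeasurableEquiv.measurable _) (by fun_prop)]
  simp only [Complex.zero_re, Complex.zero_im]
  congr 1

/-- Couples the mixtures of different signals through one common noise, so that their amplitudes
differ by the deterministic shift `α - β`. -/
theorem amplitudeLaw_eq_map (N : ℝ≥0) {k : ℕ} (α : EuclideanSpace ℂ (Fin k)) :
    amplitudeLaw N α = (amplitudeLaw N (0 : EuclideanSpace ℂ (Fin k))).map (fun z i => z i + α i) := by
  have := Measure.pi_map_pi (μ := fun _ : Fin k => complexGaussian 0 N)
    (f := fun i z => z + α i) fun i => by fun_prop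
  simp only [amplitudeLaw, PiLp.zero_apply]
  rw [this]
  simp only [← complexGaussian_eq_map]

/-- The states of two signals are hard to tell apart if the signals are close. -/
theorem re_trace_sub_le {k : ℕ} (N : ℝ≥0) (α β : EuclideanSpace ℂ (Fin k))
    (T : Fock k →L[ℂ] Fock k) (hT : ‖T‖ ≤ 1) :
    (trace (receivedState N α * T)).re - (trace (receivedState N β * T)).re ≤ 2 * ‖α - β‖ := by
  have hc : Continuous fun z : Fin k → ℂ => inner ℂ (coherentProd z) (T (coherentProd z)) := by
    have := continuous_coherentProd (k := k)
    fun_prop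
  have hm : ∀ γ : EuclideanSpace ℂ (Fin k), Continuous fun (z : Fin k → ℂ) i => z i + γ i :=
    fun γ => by fun_prop
  have hi : ∀ γ : EuclideanSpace ℂ (Fin k), Integrable (fun z : Fin k → ℂ =>
      inner ℂ (coherentProd fun i => z i + γ i) (T (coherentProd fun i => z i + γ i)))
      (amplitudeLaw N (0 : EuclideanSpace ℂ (Fin k))) := fun γ => by
    refine Integrable.of_bound (hc.comp (hm γ)).aestronglyMeasurable 1 (ae_of_all _ fun z => ?_)
    refine (norm_inner_le_norm _ _).trans ?_
    have := T.le_of_opNorm_le hT (coherentProd fun i => z i + γ i)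
    rw [norm_coherentProd] at this ⊢
    linarith
  have ht : ∀ γ : EuclideanSpace ℂ (Fin k), trace (receivedState N γ * T) =
      ∫ z, inner ℂ (coherentProd fun i => z i + γ i) (T (coherentProd fun i => z i + γ i))
        ∂(amplitudeLaw N (0 : EuclideanSpace ℂ (Fin k))) := fun γ => by
    rw [trace_receivedState_mul, amplitudeLaw_eq_map,
      integral_map (hm γ).measurable.aemeasurable hc.aestronglyMeasurable]
  rw [← Complex.sub_re, ht, ht, ← integral_sub (hi α) (hi β)]
  refine (Complex.re_le_norm _).trans ((norm_integral_le_of_norm_le_const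
    (C := 2 * ‖α - β‖) (ae_of_all _ fun z => ?_)).trans_eq (by simp))
  refine (norm_inner_coherentProd_sub_le T hT _ _).trans_eq ?_
  rw [EuclideanSpace.norm_eq]
  simp

/-- The test of user `m` accepts its own signal with probability at least `1 - l₁` and that of `m'`
with probability at most `l₂`; nearby signals cannot be told apart that well. -/
theorem Scheme.one_sub_le {E : ℝ} {N : ℝ≥0} {k M : ℕ} {l₁ l₂ : ℝ} (S : Scheme E N k M l₁ l₂)
    {m m' : Fin M} (h : m ≠ m') :
    1 - l₁ - l₂ ≤ 2 * ‖S.signature m - S.signature m'‖ := by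
  have hT : ‖S.test m‖ ≤ 1 := by
    refine (CStarAlgebra.norm_le_norm_of_nonneg_of_le (S.test_nonneg m)
      (S.test_le_one m)).trans ?_
    exact ContinuousLinearMap.norm_id_le
  have := re_trace_sub_le N (S.signature m) (S.signature m') (S.test m) hT
  linarith [S.first_kind m, S.second_kind m m' h.symm]

/-- The number of users is bounded by a packing bound. -/
theorem Scheme.card_le {E : ℝ} {N : ℝ≥0} {k M : ℕ} {l₁ l₂ : ℝ}
    (S : Scheme E N k M l₁ l₂) (hl : l₁ + l₂ < 1) :
    (M : ℝ) ≤ (1 + 4 * √(k * E) / (1 - l₁ - l₂)) ^ (2 * k) := by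
  have hr : 0 < (1 - l₁ - l₂) / 4 := by linarith
  have h := card_le_of_separated S.signature (Real.sqrt_nonneg (k * E)) hr
    (fun m => Real.le_sqrt_of_sq_le (S.energy m))
    fun m m' hm => by linarith [S.one_sub_le hm]
  have hd : Module.finrank ℝ (EuclideanSpace ℂ (Fin k)) = 2 * k := by
    rw [← Module.finrank_mul_finrank ℝ ℂ]; simp
  rw [hd, Fintype.card_fin] at h
  refine h.trans_eq ?_
  congr 1
  have : 1 - l₁ - l₂ ≠ 0 := by linarith
  field_simp
  ring

/-! ### Schemes with heterodyne tests -/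

theorem linForm_single {k : ℕ} (i : Fin k) (c : ℂ) (z : Fin k → ℂ) :
    linForm (Pi.single i c) z = inner ℝ c (z i) := by
  rw [linForm, Finset.sum_eq_single i]
  · simp
  · intro j _ hj
    rw [Pi.single_eq_of_ne hj, inner_zero_left]
  · simp

theorem normSq_single {k : ℕ} (i : Fin k) (c : ℂ) :
    normSq (Pi.single i c : Fin k → ℂ) = ‖c‖ ^ 2 := by
  rw [normSq, Finset.sum_eq_single i]
  · simp
  · intro j _ hj
    simp [Pi.single_eq_of_ne hj]
  · simp

theorem linForm_append {n J : ℕ} (a b : Fin n → ℂ) (c d : Fin J → ℂ) :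
    linForm (Fin.append a c) (Fin.append b d) = linForm a b + linForm c d := by
  simp only [linForm, Fin.sum_univ_add, Fin.append_left, Fin.append_right]

theorem normSq_append {n J : ℕ} (a : Fin n → ℂ) (c : Fin J → ℂ) :
    normSq (Fin.append a c) = normSq a + normSq c := by
  simp only [normSq, Fin.sum_univ_add, Fin.append_left, Fin.append_right]

/-- The unit directions of the real and imaginary axes. -/
def axis : Fin 4 → ℂ := ![1, -1, Complex.I, -Complex.I]

theorem norm_axis (s : Fin 4) : ‖axis s‖ = 1 := by
  fin_cases s <;> simp [axis]

/-- The faces along the coordinate axes confine each real and imaginary part to within `t` of that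
of `α`. They play no role in separating users; they only keep the volume finite. -/
theorem volume_polyhedron_ne_top {k : ℕ} {κ : Type*} (v : κ → Fin k → ℂ) (α : Fin k → ℂ) {t : ℝ}
    (ht : 0 ≤ t) :
    volume (polyhedron (Sum.elim (fun p : Fin k × Fin 4 => Pi.single p.1 (axis p.2)) v) α t) ≠
      ∞ := by
  refine ((measure_mono (t := Metric.closedBall α (2 * t)) fun z hz => ?_).trans_lt
    measure_closedBall_lt_top).ne
  rw [Metric.mem_closedBall, dist_pi_le_iff (by positivity)]
  intro i
  have h := fun s => hz (Sum.inl (i, s))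
  simp only [Sum.elim_inl, linForm_single] at h
  have h0 := h 0
  have h1 := h 1
  have h2 := h 2
  have h3 := h 3
  simp [axis, Complex.inner] at h0 h1 h2 h3
  rw [dist_eq_norm]
  refine (Complex.norm_le_abs_re_add_abs_im _).trans ?_
  have hre : |(z i - α i).re| ≤ t := by
    rw [abs_le, Complex.sub_re]; constructor <;> linarith
  have him : |(z i - α i).im| ≤ t := by
    rw [abs_le, Complex.sub_im]; constructor <;> linarith
  linarith

theorem linForm_eq_inner {n : ℕ} (a b : EuclideanSpace ℂ (Fin n)) :
    linForm a b = inner ℝ a b := by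
  rw [linForm, PiLp.inner_apply]

theorem normSq_eq_norm_sq {n : ℕ} (a : EuclideanSpace ℂ (Fin n)) : normSq a = ‖a‖ ^ 2 := by
  rw [EuclideanSpace.norm_sq_eq, normSq]

/-- The code of `exists_code` is sent over `n` modes for the points and `J` modes for the lifting
coordinates. A test has `4(n + J)` box faces and `J` code faces, which gives the prefactor in the
error bound. The code margin is `2t`: one `t` is the slack of the acceptance region, the other feeds
the Chernoff exponent for foreign signals. -/
theorem exists_scheme (E : ℝ) (N : ℝ≥0) (n J : ℕ) (t D : ℝ) (ht : 0 ≤ t) (hD : 1 ≤ D)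
    (h16 : 16 ≤ D ^ ((3 / 4 : ℝ) ^ J)) (ht2 : 16 * t ^ 2 ≤ D ^ ((3 / 4 : ℝ) ^ J))
    (hE : D ^ 2 * (1 + J) ≤ (n + J : ℕ) * E) (l : ℝ)
    (hl : (4 * (n + J) + J) * Real.exp (-t + (N + 1) / 2) ≤ l) :
    ∃ M : ℕ, Nonempty (Scheme E N (n + J) M l l) ∧
      (D / D ^ ((3 / 4 : ℝ) ^ J) / 8 ^ J) ^ (2 * n) ≤ M := by
  obtain ⟨ι, _, f, y, g, hf, hy, hg, hsep, hcard⟩ :=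
    exists_code (V := EuclideanSpace ℂ (Fin n)) (2 * t) J D hD h16 (by linarith)
  have hd : Module.finrank ℝ (EuclideanSpace ℂ (Fin n)) = 2 * n := by
    rw [← Module.finrank_mul_finrank ℝ ℂ]; simp
  rw [hd] at hcard
  refine ⟨Fintype.card ι, ?_, hcard⟩
  let e := (Fintype.equivFin ι).symm
  let σ : ι → EuclideanSpace ℂ (Fin (n + J)) := fun x =>
    WithLp.toLp 2 (Fin.append (f x) fun j => (y x j : ℂ))
  let v : ι → Fin J → Fin (n + J) → ℂ := fun x j => Fin.append (g x j) (Pi.single j 1)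
  let u : ι → (Fin (n + J) × Fin 4) ⊕ Fin J → Fin (n + J) → ℂ := fun x =>
    Sum.elim (fun p => Pi.single p.1 (axis p.2)) (v x)
  have hvol : ∀ x, volume (polyhedron (u x) (σ x) t) ≠ ∞ := fun x =>
    volume_polyhedron_ne_top (v x) (σ x) ht
  have hu : ∀ x j, normSq (u x j) ≤ 2 := by
    rintro x (p | j)
    · simp only [u, Sum.elim_inl, normSq_single, norm_axis]
      norm_num
    · simp only [u, Sum.elim_inr, v, normSq_append, normSq_single, normSq_eq_norm_sq, norm_one]
      have := pow_le_one₀ (n := 2) (norm_nonneg (g x j)) (hg x j)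
      linarith
  have hexp : ∀ x j, Real.exp (-t + (N + 1) * normSq (u x j) / 4) ≤
      Real.exp (-t + (N + 1) / 2) := fun x j => by
    refine Real.exp_le_exp.2 ?_
    have : (N + 1 : ℝ) * normSq (u x j) ≤ (N + 1) * 2 := by gcongr; exact hu x j
    linarith
  have hv : ∀ x x' (j : Fin J), linForm (v x j) (σ x') = inner ℝ (g x j) (f x') + y x' j :=
    fun x x' j => by
      simp only [v, σ, linForm_append, linForm_single, linForm_eq_inner]
      simp [Complex.inner]
  -- A single face's error is below the total as soon as the prefactor is at least one. For `J = 0`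
  -- this may fail, but then no two users need to be separated.
  have hcardpos : ∀ x : ι, Real.exp (-t + (N + 1) / 2) ≤ l ∨ J = 0 := fun x => by
    rcases Nat.eq_zero_or_pos J with h | h
    · exact Or.inr h
    · left
      refine le_trans (le_mul_of_one_le_left (Real.exp_pos _).le ?_) hl
      have : (1 : ℝ) ≤ J := by exact_mod_cast h
      linarith [n.cast_nonneg (α := ℝ)]
  refine ⟨⟨fun m => σ (e m), fun m => heterodyne (polyhedron (u (e m)) (σ (e m)) t), ?_,
    fun m => heterodyne_nonneg _ (hvol _), fun m => heterodyne_le_one _ (hvol _), ?_, ?_⟩⟩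
  · intro m
    refine le_trans ?_ hE
    have h1 : ‖f (e m)‖ ^ 2 ≤ (D / 4) ^ 2 := pow_le_pow_left₀ (norm_nonneg _) (hf _) 2
    have h2 : ∀ j : Fin J, ‖(y (e m) j : ℂ)‖ ^ 2 ≤ D ^ 2 := fun j => by
      rw [Complex.norm_real, Real.norm_eq_abs]
      refine pow_le_pow_left₀ (abs_nonneg _) ((hy _ _).trans ?_) 2
      linarith
    have h3 := Finset.sum_le_sum fun j (_ : j ∈ Finset.univ) => h2 j
    rw [Finset.sum_const, Finset.card_univ, Fintype.card_fin, nsmul_eq_mul] at h3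
    have h4 : ‖σ (e m)‖ ^ 2 = ‖f (e m)‖ ^ 2 + ∑ j : Fin J, ‖(y (e m) j : ℂ)‖ ^ 2 := by
      rw [← normSq_eq_norm_sq, ← normSq_eq_norm_sq]
      exact normSq_append _ _
    rw [h4]
    nlinarith [sq_nonneg D]
  · intro m
    refine (one_sub_re_trace_heterodyne_polyhedron_le N (σ (e m)) (u (e m)) t (hvol _)).trans ?_
    refine (Finset.sum_le_sum fun j _ => hexp (e m) j).trans (le_trans (le_of_eq ?_) hl)
    rw [Finset.sum_const, nsmul_eq_mul, Finset.card_univ, Fintype.card_sum, Fintype.card_prod,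
      Fintype.card_fin, Fintype.card_fin, Fintype.card_fin]
    push_cast
    ring
  · intro m m' hne
    obtain ⟨j, hj, h⟩ := hsep (e m) (e m') fun h => hne (e.injective h).symm
    have hexpl : Real.exp (-t + (N + 1) / 2) ≤ l :=
      (hcardpos (e m)).resolve_right (by omega)
    refine (re_trace_heterodyne_le N (σ (e m')) _ (hvol _) (measurableSet_polyhedron _ _ _)
      (u (e m) (Sum.inr ⟨j, hj⟩)) _ fun z hz => hz (Sum.inr ⟨j, hj⟩)).trans
      (le_trans (le_trans (Real.exp_le_exp.2 ?_) (hexp (e m) (Sum.inr ⟨j, hj⟩))) hexpl)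
    have h1 := hv (e m) (e m') ⟨j, hj⟩
    have h2 := hv (e m) (e m) ⟨j, hj⟩
    rw [inner_sub_right] at h
    simp only [u, Sum.elim_inr]
    rw [h1, h2]
    simp only
    linarith

/-! ### Asymptotics -/

theorem tendsto_log_natCast : Tendsto (fun k : ℕ => Real.log k) atTop atTop :=
  Real.tendsto_log_atTop.comp tendsto_natCast_atTop_atTop

/-- With `θ = (3/4) ^ J < 1 - R`, scale `D = √(kE / (1 + J))` and margin `t = 2 log k`, the energy
constraint is met, the errors are of order `k · k⁻² = 1/k`, and the leading term of `log M` is `(1 -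
θ) k log k`. The code conditions hold eventually since `log² k` is negligible against `D ^ θ`. -/
theorem exists_scheme_of_lt_one {E : ℝ} (hE : 0 < E) (N : ℝ≥0) {R : ℝ} (hR : R < 1) :
    ∃ l : ℕ → ℝ, Tendsto l atTop (𝓝 0) ∧ ∀ᶠ k : ℕ in atTop,
      ∃ M : ℕ, Nonempty (Scheme E N k M (l k) (l k)) ∧
        R * (k * Real.log k) ≤ Real.log M := by
  obtain ⟨J, hJ⟩ := exists_pow_lt_of_lt_one (show (0 : ℝ) < 1 - R by linarith)
    (show (3 / 4 : ℝ) < 1 by norm_num)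
  set θ : ℝ := (3 / 4) ^ J with hθ
  have hθ0 : 0 < θ := by positivity
  set a : ℝ := E / (1 + J) with ha
  have ha0 : 0 < a := by positivity
  set C : ℝ := (4 + J) * Real.exp ((N + 1) / 2) with hC
  refine ⟨fun k => C / k, tendsto_const_div_atTop_nhds_zero_nat C, ?_⟩
  have hka : Tendsto (fun k : ℕ => (k : ℝ) * a) atTop atTop :=
    tendsto_natCast_atTop_atTop.atTop_mul_const ha0
  have hDθ : Tendsto (fun k : ℕ => ((k : ℝ) * a) ^ (θ / 2)) atTop atTop :=
    (tendsto_rpow_atTop (by positivity)).comp hka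
  have hlog : ∀ᶠ k : ℕ in atTop, 64 * Real.log k ^ 2 ≤ ((k : ℝ) * a) ^ (θ / 2) := by
    have h := (isLittleO_log_rpow_atTop (show 0 < θ / 4 by positivity)).def
      (show 0 < a ^ (θ / 4) / 8 by positivity)
    filter_upwards [tendsto_natCast_atTop_atTop.eventually h] with k hk
    have hk0 : (0 : ℝ) ≤ k := k.cast_nonneg
    rw [Real.norm_eq_abs, Real.norm_of_nonneg (by positivity)] at hk
    have h2 := pow_le_pow_left₀ (abs_nonneg _) hk 2
    rw [sq_abs] at h2
    have h3 : ((k : ℝ) * a) ^ (θ / 2) = (((k : ℝ) * a) ^ (θ / 4)) ^ 2 := by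
      rw [← Real.rpow_natCast, ← Real.rpow_mul (by positivity)]
      congr 1
      push_cast
      ring
    rw [h3, Real.mul_rpow hk0 ha0.le]
    nlinarith
  have hrate : ∀ᶠ k : ℕ in atTop, R * (k * Real.log k) ≤
      ((k : ℝ) - J) * ((1 - θ) * (Real.log k + Real.log a) - 2 * (J * Real.log 8)) := by
    have h1 : Tendsto (fun k : ℕ => (1 - J / (k : ℝ)) *
        ((1 - θ) + ((1 - θ) * Real.log a - 2 * (J * Real.log 8)) / Real.log k)) atTop
        (𝓝 ((1 - 0) * ((1 - θ) + 0))) :=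
      (tendsto_const_nhds.sub (tendsto_const_div_atTop_nhds_zero_nat _)).mul
        (tendsto_const_nhds.add (tendsto_log_natCast.const_div_atTop _))
    have h2 : R < (1 - 0) * ((1 - θ) + 0) := by linarith
    filter_upwards [h1.eventually_const_lt h2, eventually_gt_atTop 0,
      tendsto_log_natCast.eventually_gt_atTop 0] with k hk hk0 hl0
    have hk0' : (0 : ℝ) < k := by exact_mod_cast hk0
    have := mul_le_mul_of_nonneg_right hk.le (mul_pos hk0' hl0).le
    refine this.trans_eq ?_
    field_simp
    ring
  filter_upwards [hlog, hrate, hka.eventually_ge_atTop 1, hDθ.eventually_ge_atTop 16,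
    eventually_ge_atTop (J + 1)] with k h1 h2 h3 h4 h5
  obtain ⟨n, rfl⟩ : ∃ n, k = n + J := ⟨k - J, by omega⟩
  have hk1 : (1 : ℝ) ≤ (n + J : ℕ) := by exact_mod_cast (by omega : 1 ≤ n + J)
  generalize hkk : ((n + J : ℕ) : ℝ) = κ at *
  have hκ0 : 0 < κ := by linarith
  have hD0 : 0 < √(κ * a) := Real.sqrt_pos.2 (by positivity)
  have hDpow : √(κ * a) ^ θ = (κ * a) ^ (θ / 2) := by
    rw [Real.sqrt_eq_rpow, ← Real.rpow_mul (by positivity)]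
    congr 1
    ring
  obtain ⟨M, hM, hM2⟩ := exists_scheme E N n J (2 * Real.log κ) (√(κ * a))
    (mul_nonneg zero_le_two (Real.log_nonneg hk1))
    (Real.one_le_sqrt.2 h3) (by rw [← hθ, hDpow]; exact h4)
    (by rw [← hθ, hDpow]; linarith)
    (by rw [Real.sq_sqrt (by positivity), hkk, ha]; exact le_of_eq (by field_simp))
    (C / κ) (by
      have hnJ : (n : ℝ) + J = κ := by rw [← hkk]; push_cast; rfl
      have he : Real.exp (-(2 * Real.log κ) + (N + 1) / 2) =
          Real.exp ((N + 1) / 2) / κ ^ 2 := by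
        rw [Real.exp_add, Real.exp_neg, ← Real.log_rpow hκ0 2,
          Real.exp_log (by positivity), Real.rpow_two]
        ring
      rw [hnJ, he, hC, mul_div_assoc', div_le_div_iff₀ (by positivity) hκ0]
      have : (4 * κ + J) ≤ (4 + J) * κ := by nlinarith [J.cast_nonneg (α := ℝ)]
      calc (4 * κ + J) * Real.exp ((N + 1) / 2) * κ
          ≤ (4 + J) * κ * Real.exp ((N + 1) / 2) * κ := by gcongr
        _ = _ := by ring)
  refine ⟨M, hM, h2.trans ?_⟩
  clear_value a
  have hpos : 0 < √(κ * a) / √(κ * a) ^ θ / 8 ^ J := by positivity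
  have hlogM := Real.log_le_log (pow_pos hpos (2 * n)) hM2
  refine le_trans (le_of_eq ?_) hlogM
  rw [Real.log_pow, Real.log_div (by positivity) (by positivity),
    Real.log_div (by positivity) (by positivity), Real.log_rpow hD0, Real.log_sqrt (by positivity),
    Real.log_mul hκ0.ne' ha0.ne', Real.log_pow]
  have hnJ : (n : ℝ) = κ - J := by rw [← hkk]; push_cast; ring
  push_cast
  rw [hnJ]
  ring

/-- The threshold on `k` is uniform in the error levels once `l₁ + l₂ ≤ 1 - c`. This serves both
vanishing errors and fixed ones. -/
theorem eventually_log_card_lt (E : ℝ) (N : ℝ≥0) {c R : ℝ} (hc : 0 < c) (hR : 1 < R) :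
    ∀ᶠ k : ℕ in atTop, ∀ (M : ℕ) (l₁ l₂ : ℝ), l₁ + l₂ ≤ 1 - c →
      Nonempty (Scheme E N k M l₁ l₂) → Real.log M < R * (k * Real.log k) := by
  set b : ℝ := 4 * √E / c with hb
  have hb0 : 0 ≤ b := by positivity
  have h1 : Tendsto (fun k : ℕ => 1 + 2 * Real.log (1 + b) / Real.log k) atTop (𝓝 (1 + 0)) :=
    tendsto_const_nhds.add (tendsto_log_natCast.const_div_atTop _)
  filter_upwards [h1.eventually_lt_const (by linarith : 1 + 0 < R), eventually_ge_atTop 1,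
    tendsto_log_natCast.eventually_gt_atTop 0] with k hk hk1 hl0
  rintro M l₁ l₂ hl ⟨S⟩
  have hk1' : (1 : ℝ) ≤ k := by exact_mod_cast hk1
  have hk0 : (0 : ℝ) < k := by linarith
  have hpos : 0 < R * (k * Real.log k) := by positivity
  rcases Nat.eq_zero_or_pos M with rfl | hM
  · simpa using hpos
  have hs : 1 ≤ √(k : ℝ) := Real.one_le_sqrt.2 hk1'
  have h2 : (M : ℝ) ≤ ((1 + b) * √k) ^ (2 * k) := by
    refine (S.card_le (by linarith)).trans ?_
    have h3 : 4 * √(k * E) / (1 - l₁ - l₂) ≤ b * √k := by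
      rw [Real.sqrt_mul hk0.le, hb, div_mul_eq_mul_div]
      refine div_le_div₀ (by positivity) (le_of_eq (by ring)) hc (by linarith)
    have h4 : 0 ≤ 4 * √(k * E) / (1 - l₁ - l₂) := div_nonneg (by positivity) (by linarith)
    refine pow_le_pow_left₀ (by linarith) ?_ _
    linarith
  have h5 := Real.log_le_log (by exact_mod_cast hM) h2
  rw [Real.log_pow, Real.log_mul (by positivity) (by positivity), Real.log_sqrt hk0.le] at h5
  refine h5.trans_lt ?_
  have h6 := mul_lt_mul_of_pos_right hk (mul_pos hk0 hl0)
  refine lt_of_eq_of_lt ?_ h6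
  push_cast
  field_simp
  ring

/-! ### The capacity and the strong converse -/

/-- A scheme remains one if the error bounds are relaxed. -/
def Scheme.relax {E : ℝ} {N : ℝ≥0} {k M : ℕ} {l₁ l₂ l₁' l₂' : ℝ} (S : Scheme E N k M l₁ l₂)
    (h₁ : l₁ ≤ l₁') (h₂ : l₂ ≤ l₂') : Scheme E N k M l₁' l₂' where
  signature := S.signature
  test := S.test
  energy := S.energy
  test_nonneg := S.test_nonneg
  test_le_one := S.test_le_one
  first_kind m := (S.first_kind m).trans h₁
  second_kind m m' h := (S.second_kind m m' h).trans h₂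

theorem nonempty_scheme_zero (E : ℝ) (N : ℝ≥0) (k : ℕ) (l₁ l₂ : ℝ) :
    Nonempty (Scheme E N k 0 l₁ l₂) :=
  ⟨⟨Fin.elim0, Fin.elim0, fun m => m.elim0, fun m => m.elim0, fun m => m.elim0, fun m => m.elim0,
    fun m => m.elim0⟩⟩

/-- Block lengths too small for the construction receive the scheme without users, which does not
affect the limit inferior. -/
theorem achievable_of_lt_one {E : ℝ} (hE : 0 < E) (N : ℝ≥0) {R : ℝ} (hR : R < 1) :
    Achievable E N R := by
  classical
  obtain ⟨l, hl, h⟩ := exists_scheme_of_lt_one hE N hR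
  have hex : ∀ k : ℕ, ∃ M : ℕ, Nonempty (Scheme E N k M (l k) (l k)) ∧
      ((∃ M : ℕ, Nonempty (Scheme E N k M (l k) (l k)) ∧
        R * (k * Real.log k) ≤ Real.log M) → R * (k * Real.log k) ≤ Real.log M) := fun k => by
    by_cases hk : ∃ M : ℕ, Nonempty (Scheme E N k M (l k) (l k)) ∧
        R * (k * Real.log k) ≤ Real.log M
    · obtain ⟨M, h1, h2⟩ := hk
      exact ⟨M, h1, fun _ => h2⟩
    · exact ⟨0, nonempty_scheme_zero _ _ _ _ _, fun h => absurd h hk⟩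
  choose M hM hM2 using hex
  refine ⟨M, l, l, hM, hl, hl, fun R' hR' => ?_⟩
  filter_upwards [h, tendsto_log_natCast.eventually_ge_atTop 0] with k hk hl0
  refine le_trans ?_ (hM2 k hk)
  have : 0 ≤ (k : ℝ) * Real.log k := mul_nonneg k.cast_nonneg hl0
  gcongr

theorem Achievable.le_one {E : ℝ} {N : ℝ≥0} {R : ℝ} (h : Achievable E N R) : R ≤ 1 := by
  obtain ⟨M, l₁, l₂, hS, h₁, h₂, hrate⟩ := h
  by_contra! hR
  have hlt := (h₁.add h₂).eventually_lt_const (show (0 : ℝ) + 0 < 1 / 2 by norm_num)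
  -- The rate `(1 + R) / 2` lies strictly between `1` and `R`: above `1` for the converse, below `R`
  -- for achievability, so the two bounds clash at a common `k`.
  obtain ⟨k, hk1, hk2, hk3⟩ := (hlt.and ((eventually_log_card_lt E N (c := 1 / 2)
    (R := (1 + R) / 2) (by norm_num) (by linarith)).and
    (hrate ((1 + R) / 2) (by linarith)))).exists
  exact absurd (hk2 (M k) (l₁ k) (l₂ k) (by linarith) (hS k)) hk3.not_gt

theorem idCapacity_eq_one {E : ℝ} (hE : 0 < E) (N : ℝ≥0) : idCapacity E N = 1 := by
  refine le_antisymm (sSup_le ?_) (le_of_forall_lt fun c hc => ?_)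
  · rintro _ ⟨R, hR, rfl⟩
    exact_mod_cast Achievable.le_one hR
  · obtain ⟨R, hcR, hR⟩ := EReal.lt_iff_exists_real_btwn.1 hc
    refine hcR.trans_le (le_sSup ⟨R, achievable_of_lt_one hE N ?_, rfl⟩)
    exact_mod_cast hR

theorem exists_isGreatest_scheme (E : ℝ) (N : ℝ≥0) (k : ℕ) {l₁ l₂ : ℝ} (hl : l₁ + l₂ < 1) :
    ∃ M, IsGreatest {m : ℕ | Nonempty (Scheme E N k m l₁ l₂)} M := by
  have hb : BddAbove {m : ℕ | Nonempty (Scheme E N k m l₁ l₂)} :=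
    ⟨_, fun m ⟨S⟩ => Nat.le_floor (S.card_le hl)⟩
  exact ⟨_, Nat.sSup_mem ⟨0, nonempty_scheme_zero E N k l₁ l₂⟩ hb, fun m hm => le_csSup hb hm⟩

end BosonicID

open BosonicID in
theorem corollary1 (E : ℝ) (hE : 0 < E) (N : ℝ≥0) :
    BosonicID.idCapacity E N = 1 ∧
    ∀ l₁ l₂ : ℝ, 0 < l₁ → 0 < l₂ → l₁ + l₂ < 1 →
      ∃ M : ℕ → ℕ,
        (∀ k, IsGreatest {m : ℕ | Nonempty (BosonicID.Scheme E N k m l₁ l₂)} (M k)) ∧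
        Tendsto (fun k : ℕ => Real.log (M k) / (k * Real.log k)) atTop (𝓝 1) := by
  refine ⟨idCapacity_eq_one hE N, fun l₁ l₂ h₁ h₂ hl => ?_⟩
  choose M hM using fun k => exists_isGreatest_scheme E N k hl
  refine ⟨M, hM, tendsto_order.2 ⟨fun R hR => ?_, fun R hR => ?_⟩⟩
  · obtain ⟨l, hl0, h⟩ := exists_scheme_of_lt_one hE N (show (R + 1) / 2 < 1 by linarith)
    filter_upwards [h, hl0.eventually_lt_const h₁, hl0.eventually_lt_const h₂,
      tendsto_log_natCast.eventually_gt_atTop 0, eventually_gt_atTop 0]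
      with k ⟨M', ⟨S⟩, hrate⟩ hk₁ hk₂ hlog hk
    have hk0 : (0 : ℝ) < k := by exact_mod_cast hk
    have hle : M' ≤ M k := (hM k).2 ⟨S.relax hk₁.le hk₂.le⟩
    have hlogle : Real.log M' ≤ Real.log (M k) := by
      rcases Nat.eq_zero_or_pos M' with rfl | hpos
      · simpa using Real.log_natCast_nonneg (M k)
      · exact Real.log_le_log (by exact_mod_cast hpos) (by exact_mod_cast hle)
    rw [lt_div_iff₀ (mul_pos hk0 hlog)]
    have : R * (k * Real.log k) < (R + 1) / 2 * (k * Real.log k) :=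
      mul_lt_mul_of_pos_right (by linarith) (mul_pos hk0 hlog)
    linarith
  · filter_upwards [eventually_log_card_lt E N (c := 1 - l₁ - l₂) (by linarith) hR,
      tendsto_log_natCast.eventually_gt_atTop 0, eventually_gt_atTop 0] with k hk hlog hk'
    have hk0 : (0 : ℝ) < k := by exact_mod_cast hk'
    rw [div_lt_iff₀ (mul_pos hk0 hlog)]
    exact hk (M k) l₁ l₂ (by linarith) (hM k).1
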